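/- \textbf{Setting.} Let $V$ be a countable set, let $J=(J_{x,y})_{x,y\in V}$ be real numbers with $J_{x,y}=J_{y,x}$, and let $f:\mathbb{R}\to[1,\infty)$ and $\delta_f,M_f>0$ be such that $f(t)\ge \sqrt{\log(|t|^{-1})}$ for all $t\in(-\delta_f,\delta_f)\setminus\{0\}$ (no condition being imposed by this at $|t|>1$) and $\sum_{y\in V}|J_{x,y}|f(J_{x,y})\le M_f$ for all $x\in V$. For $\beta\ge 0$, a Borel measure $\rho$ on $\mathbb{R}$, a finite set $\Lambda\subset V$ and boundary conditions $\xi\in\mathbb{R}^V$ with $\sum_{y\in V}|J_{x,y}\xi_y|<\infty$ for all $x\in\Lambda$, let $\nu^{\xi}_{\Lambda,\beta,\rho,J}$ be the probability measure on $\mathbb{R}^\Lambda$ given by \[ \mathrm{d}\nu^{\xi}_{\Lambda,\beta,\rho,J}[\varphi]=\frac{1}{Z^{\xi}_{\Lambda,\beta,\rho,J}}\exp\Big(\beta\sum_{\{x,y\}\subset\Lambda,\,x\neq y}J_{x,y}\varphi_x\varphi_y+\beta\sum_{x\in\Lambda}h_{x,\Lambda}\varphi_x\Big)\prod_{x\in\Lambda}\mathrm{d}\rho(\varphi_x),\qquad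 h_{x,\Lambda}=\sum_{y\in V\setminus\Lambda}J_{x,y}\xi_y , \] where $Z^{\xi}_{\Lambda,\beta,\rho,J}$ is the normalising constant. For $b\in\mathbb{R}$ let $\mathrm{d}\rho_b(u)=e^{b|u|^2}\mathrm{d}\rho(u)$. For $C\ge1$, $\lambda\ge1$ and $x\in\Lambda$, let $A(x,\Lambda,\lambda,\xi,C)$ be the smallest $A\ge1$ such that \[ |h_{x_m,\Lambda}|\le\Big(\sum_{z\in V\setminus\Lambda}|J_{x_m,z}|f(J_{x_m,z})\Big)\,C\,A\,\lambda^{m+1}\prod_{i=1}^m f(J_{x_{i-1},x_i}) \] for all $m\ge0$ and all sequences $x=x_0,x_1,\dots,x_m\in\Lambda$ (not necessarily distinct) with $J_{x_{i-1},x_i}\neq0$ for $1\le i\le m$ (and $A(x,\Lambda,\lambda,\xi,C)=\infty$ if there is no such $A$). \textbf{Theorem.} Let $\beta\ge0$, $\delta_f,M_f>0$, let $a\ge4\beta M_f$ and let $\rho$ be a Borel measure on $\mathbb{R}$ with $0<\int_{\mathbb{R}}e^{a|u|^2}\,\mathrm{d}\rho(u)<\infty$. There exist $C\ge1$ and $\tilde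 C>0$, depending only on $\beta,\delta_f,M_f,\rho$ and $a$, such that for all $V$, $J$, $f$ as above (with these $\delta_f$, $M_f$), all finite $\Lambda\subset V$, all $\Lambda'\subset\Lambda$, all $\lambda\ge1$ with $4\beta M_f\lambda\le a$ (that is, $\lambda\le\frac{a}{4\beta M_f}$ when $\beta>0$), and all $\xi\in\mathbb{R}^V$ with $\sum_{y\in V}|J_{x,y}\xi_y|<\infty$ for all $x\in\Lambda$, the measure $\nu^{\xi}_{\Lambda,\beta,\rho,J}$ is a well-defined probability measure and \[ \mathrm{d}\nu^{\xi}_{\Lambda,\beta,\rho,J}[\varphi|_{\Lambda'}=\psi]\le\Big(\prod_{x\in\Lambda'}e^{\tilde C A(x,\Lambda,\lambda,\xi,C)^2}\Big)\,\mathrm{d}\nu^{0}_{\Lambda',0,\rho_{a/2},0}[\psi], \] as an inequality between measures on $\mathbb{R}^{\Lambda'}$: the law of $\varphi|_{\Lambda'}$ under $\nu^{\xi}_{\Lambda,\beta,\rho,J}$ has a density with respect to the product probability measure $\nu^{0}_{\Lambda',0,\rho_{a/2},0}=\bigotimes_{x\in\Lambda'}\rho_{a/2}/\rho_{a/2}(\mathbb{R})$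 that is bounded by $\prod_{x\in\Lambda'}e^{\tilde C A(x,\Lambda,\lambda,\xi,C)^2}$ for almost every $\psi\in\mathbb{R}^{\Lambda'}$. -/

import Mathlib

open MeasureTheory

universe u

noncomputable section

namespace SpinSystem

variable {V : Type*}

/-- Admissible interactions for the exponent `n = 2`: `J` is symmetric, `f` takes values in
`[1, ∞)`, `f t ≥ (log (1 / |t|)) ^ (1 / 2)` for `0 ≠ t ∈ (-δ, δ)`, and
`∑ y, |J x y| * f (J x y) ≤ M` for every vertex `x`. -/
structure IsAdmissible (J : V → V → ℝ) (f : ℝ → ℝ) (δ M : ℝ) : Prop where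
  symm : ∀ x y, J x y = J y x
  one_le : ∀ t, 1 ≤ f t
  sqrt_log_le : ∀ t, t ≠ 0 → |t| < δ → √(Real.log |t|⁻¹) ≤ f t
  summable : ∀ x, Summable fun y => |J x y| * f (J x y)
  tsum_le : ∀ x, ∑' y, |J x y| * f (J x y) ≤ M

/-- The external field `h_{x, R} = ∑_{y ∉ R} J_{x, y} ξ_y`. -/
def externalField (J : V → V → ℝ) (ξ : V → ℝ) (R : Set V) (x : V) : ℝ :=
  ∑' y : ↥Rᶜ, J x y * ξ y

open Classical in
/-- The Hamiltonian on the finite set `Λ` with boundary conditions `ξ`. For symmetric `J`, half the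
sum over ordered pairs of distinct vertices of `Λ` is the sum over unordered pairs. -/
def hamiltonian (J : V → V → ℝ) (ξ : V → ℝ) (Λ : Finset V) (φ : Λ → ℝ) : ℝ :=
  -(1 / 2 * ∑ x : Λ, ∑ y : Λ, if x ≠ y then J x y * φ x * φ y else 0)
    - ∑ x : Λ, externalField J ξ Λ x * φ x

/-- The unnormalised Gibbs measure `exp (-β H) ∏ dρ(φ_x)` on `ℝ^Λ`. -/
def gibbsWeight (β : ℝ) (ρ : Measure ℝ) (J : V → V → ℝ) (ξ : V → ℝ) (Λ : Finset V) :
    Measure (Λ → ℝ) :=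
  (Measure.pi fun _ : Λ => ρ).withDensity
    fun φ => ENNReal.ofReal (Real.exp (-β * hamiltonian J ξ Λ φ))

/-- The partition function. -/
def partitionFunction (β : ℝ) (ρ : Measure ℝ) (J : V → V → ℝ) (ξ : V → ℝ) (Λ : Finset V) :
    ENNReal :=
  gibbsWeight β ρ J ξ Λ Set.univ

/-- The finite-volume spin model `ν_{Λ, β, ρ, J}^ξ` on `ℝ^Λ`. -/
def gibbsMeasure (β : ℝ) (ρ : Measure ℝ) (J : V → V → ℝ) (ξ : V → ℝ) (Λ : Finset V) :
    Measure (Λ → ℝ) :=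
  (partitionFunction β ρ J ξ Λ)⁻¹ • gibbsWeight β ρ J ξ Λ

/-- The measure `ρ_b`, given by `dρ_b(u) = exp (b |u| ^ 2) dρ(u)`. -/
def tilt (ρ : Measure ℝ) (b : ℝ) : Measure ℝ :=
  ρ.withDensity fun u => ENNReal.ofReal (Real.exp (b * |u| ^ 2))

/-- `p 0, …, p m` is a walk from `S` to `T` in `(R, J)`: consecutive vertices interact and all the
intermediate vertices are in `R`. The values `p i` for `i > m` play no role. -/
structure IsWalk (J : V → V → ℝ) (R S T : Set V) (m : ℕ) (p : ℕ → V) : Prop where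
  start_mem : p 0 ∈ S
  end_mem : p m ∈ T
  mem : ∀ i, 0 < i → i < m → p i ∈ R
  ne_zero : ∀ i < m, J (p i) (p (i + 1)) ≠ 0

/-- The condition on `A` in the definition of `A(x, R)` (for `n = 2`). -/
def BoundaryCondition (J : V → V → ℝ) (f : ℝ → ℝ) (ξ : V → ℝ) (C lam : ℝ) (R : Set V) (x : V)
    (A : ℝ) : Prop :=
  ∀ (m : ℕ) (p : ℕ → V), IsWalk J R {x} R m p →
    |externalField J ξ R (p m)| ≤
      (∑' z : ↥Rᶜ, |J (p m) z| * f (J (p m) z)) * C * A * lam ^ (m + 1) *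
        ∏ i ∈ Finset.range m, f (J (p i) (p (i + 1)))

/-- The boundary function `A(x, R) = A(x, R, λ, ξ, C, J, f)` for `n = 2`: the smallest real `A ≥ 1`
satisfying the condition above, and `∞` if there is none. -/
def boundaryFunction (J : V → V → ℝ) (f : ℝ → ℝ) (ξ : V → ℝ) (C lam : ℝ) (R : Set V) (x : V) :
    ENNReal :=
  sInf {b | ∃ A : ℝ, 1 ≤ A ∧ BoundaryCondition J f ξ C lam R x A ∧ b = ENNReal.ofReal A}

end SpinSystem

end

noncomputable section

namespace SpinSystem

open scoped ENNReal

section Forests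

variable {ι : Type*}

/-- The vertices that can be reached from `S` by steps of `r` that stay in `B`. -/
inductive ReachedFrom (r : ι → ι → Prop) (S B : Finset ι) : ι → Prop
  | base {x : ι} : x ∈ S → ReachedFrom r S B x
  | step {z y : ι} : ReachedFrom r S B z → y ∈ B → r z y → ReachedFrom r S B y

/-- The largest weight `∏ y ∈ B, q y` of a configuration `q` all of whose vertices in `B` are
reached from `S` through edges `(z, y)` with `q y ≤ w z y`. -/
def forestBound (w : ι → ι → ℝ≥0∞) (S B : Finset ι) : ℝ≥0∞ :=
  ⨆ (q : ι → ℝ≥0∞) (_ : ∀ y ∈ B, ReachedFrom (fun z y => q y ≤ w z y) S B y), ∏ y ∈ B, q y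

theorem prod_le_forestBound {w : ι → ι → ℝ≥0∞} {S B : Finset ι} {q : ι → ℝ≥0∞}
    (h : ∀ y ∈ B, ReachedFrom (fun z y => q y ≤ w z y) S B y) :
    ∏ y ∈ B, q y ≤ forestBound w S B :=
  le_iSup₂_of_le q h le_rfl

theorem not_reachedFrom_empty {r : ι → ι → Prop} {B : Finset ι} {y : ι} :
    ¬ ReachedFrom r ∅ B y := by
  intro h
  induction h with
  | base h => simp at h
  | step _ _ _ ih => exact ih

theorem sum_forestBound_empty (w : ι → ι → ℝ≥0∞) (U : Finset ι) :
    ∑ B ∈ U.powerset, forestBound w ∅ B ≤ 1 := by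
  rw [Finset.sum_eq_single ∅]
  · simp [forestBound]
  · intro B _ hB
    obtain ⟨y, hy⟩ := Finset.nonempty_iff_ne_empty.2 hB
    refine le_antisymm (iSup₂_le fun q hq => absurd (hq y hy) not_reachedFrom_empty) zero_le
  · simp

variable [DecidableEq ι]

theorem forestBound_le_sum (w : ι → ι → ℝ≥0∞) {S B : Finset ι} {x : ι} (hx : x ∉ B) :
    forestBound w S B ≤ ∑ N ∈ B.powerset,
      (∏ y ∈ N, w x y) * forestBound w (S.erase x ∪ N) (B \ N) := by
  classical
  refine iSup₂_le fun q hq => ?_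
  set N := B.filter fun y => q y ≤ w x y with hN
  have hNB : N ⊆ B := Finset.filter_subset _ _
  have key : ∀ y, ReachedFrom (fun z y => q y ≤ w z y) S B y → y ≠ x →
      ReachedFrom (fun z y => q y ≤ w z y) (S.erase x ∪ N) (B \ N) y := by
    intro y hy
    induction hy with
    | base h => exact fun hx => .base (by simp [h, hx])
    | @step z y _ hyB hzy ih =>
      intro _
      by_cases hyN : y ∈ N
      · exact .base (by simp [hyN])
      · have hzx : z ≠ x := by
          rintro rfl
          exact hyN (by simp [hN, hyB, hzy])
        exact .step (ih hzx) (by simp [hyB, hyN]) hzy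
  have hle : ∏ y ∈ B, q y ≤ (∏ y ∈ N, w x y) * forestBound w (S.erase x ∪ N) (B \ N) := by
    rw [← Finset.prod_sdiff hNB, mul_comm]
    refine mul_le_mul' (Finset.prod_le_prod' fun y hy => (Finset.mem_filter.1 hy).2)
      (prod_le_forestBound fun y hy => ?_)
    have hyB := (Finset.mem_sdiff.1 hy).1
    exact key y (hq y hyB) (by rintro rfl; exact hx hyB)
  exact hle.trans (Finset.single_le_sum
    (f := fun N => (∏ y ∈ N, w x y) * forestBound w (S.erase x ∪ N) (B \ N))
    (fun _ _ => zero_le) (Finset.mem_powerset.2 hNB))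

theorem sum_powerset_sum_powerset_comm {M : Type*} [AddCommMonoid M] (U : Finset ι)
    (F : Finset ι → Finset ι → M) :
    ∑ B ∈ U.powerset, ∑ N ∈ B.powerset, F N (B \ N) =
      ∑ N ∈ U.powerset, ∑ B ∈ (U \ N).powerset, F N B := by
  rw [Finset.sum_sigma', Finset.sum_sigma']
  refine Finset.sum_nbij' (fun p => ⟨p.2, p.1 \ p.2⟩) (fun p => ⟨p.1 ∪ p.2, p.1⟩) ?_ ?_ ?_ ?_ ?_
  · rintro ⟨B, N⟩ h
    simp only [Finset.mem_sigma, Finset.mem_powerset] at h ⊢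
    exact ⟨h.2.trans h.1, Finset.sdiff_subset_sdiff h.1 le_rfl⟩
  · rintro ⟨N, B⟩ h
    simp only [Finset.mem_sigma, Finset.mem_powerset] at h ⊢
    exact ⟨Finset.union_subset h.1 (h.2.trans Finset.sdiff_subset), Finset.subset_union_left⟩
  · rintro ⟨B, N⟩ h
    simp only [Finset.mem_sigma, Finset.mem_powerset] at h
    simp [Finset.union_sdiff_of_subset h.2]
  · rintro ⟨N, B⟩ h
    simp only [Finset.mem_sigma, Finset.mem_powerset] at h
    have : Disjoint N B := (Finset.disjoint_sdiff (s := N) (t := U)).mono_right h.2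
    simp [Finset.union_sdiff_cancel_left this]
  · rintro ⟨B, N⟩ _
    rfl

/-- The total weight of all the forests with roots in `S` is at most `2 ^ |S|`. -/
theorem sum_forestBound_le (w : ι → ι → ℝ≥0∞) (S U : Finset ι) (hSU : Disjoint S U)
    (hw : ∀ x, ∀ U : Finset ι, ∏ y ∈ U, (1 + 2 * w x y) ≤ 2) :
    ∑ B ∈ U.powerset, forestBound w S B ≤ 2 ^ S.card := by
  induction hn : S.card + U.card using Nat.strong_induction_on generalizing S U with
  | _ n ih =>
  obtain rfl | ⟨x, hx⟩ := S.eq_empty_or_nonempty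
  · simpa using sum_forestBound_empty w U
  have hcard : (S.erase x).card + 1 = S.card := Finset.card_erase_add_one hx
  have hxU : x ∉ U := Finset.disjoint_left.1 hSU hx
  calc ∑ B ∈ U.powerset, forestBound w S B
      ≤ ∑ B ∈ U.powerset, ∑ N ∈ B.powerset,
          (∏ y ∈ N, w x y) * forestBound w (S.erase x ∪ N) (B \ N) :=
        Finset.sum_le_sum fun B hB =>
          forestBound_le_sum w fun h => hxU (Finset.mem_powerset.1 hB h)
    _ = ∑ N ∈ U.powerset, ∑ B ∈ (U \ N).powerset,
          (∏ y ∈ N, w x y) * forestBound w (S.erase x ∪ N) B :=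
        sum_powerset_sum_powerset_comm U
          (fun N B => (∏ y ∈ N, w x y) * forestBound w (S.erase x ∪ N) B)
    _ ≤ ∑ N ∈ U.powerset, (∏ y ∈ N, 2 * w x y) * 2 ^ (S.erase x).card := by
        refine Finset.sum_le_sum fun N hN => ?_
        have hNU := Finset.mem_powerset.1 hN
        have h1 : (S.erase x ∪ N).card ≤ (S.erase x).card + N.card := Finset.card_union_le _ _
        have h2 : (U \ N).card + N.card = U.card := Finset.card_sdiff_add_card_eq_card hNU
        have hd : Disjoint (S.erase x ∪ N) (U \ N) := by
          rw [Finset.disjoint_union_left]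
          exact ⟨(hSU.mono_left (Finset.erase_subset _ _)).mono_right Finset.sdiff_subset,
            Finset.disjoint_sdiff⟩
        rw [← Finset.mul_sum, Finset.prod_mul_distrib, Finset.prod_const, mul_right_comm,
          mul_comm]
        refine mul_le_mul' ?_ le_rfl
        refine (ih _ (by omega) _ _ hd rfl).trans ?_
        rw [← pow_add, add_comm]
        exact pow_le_pow_right₀ (by norm_num) h1
    _ = (∏ y ∈ U, (1 + 2 * w x y)) * 2 ^ (S.erase x).card := by
        rw [← Finset.sum_mul, Finset.prod_one_add]
    _ ≤ 2 * 2 ^ (S.erase x).card := mul_le_mul' (hw x U) le_rfl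
    _ = 2 ^ S.card := by rw [← hcard, pow_succ, mul_comm]

end Forests

section Marginals

variable {ι : Type*} [Fintype ι] [DecidableEq ι]

theorem lintegral_eq_lmarginal_compl (σ : ι → Measure ℝ) [∀ i, IsProbabilityMeasure (σ i)]
    (B : Finset ι) {f : (ι → ℝ) → ℝ≥0∞} (hf : Measurable f) (x : ι → ℝ) :
    ∫⁻ φ, f φ ∂Measure.pi σ = lmarginal σ Bᶜ (lmarginal σ B f) x := by
  have h : (Finset.univ : Finset ι) = Bᶜ ∪ B := by
    rw [Finset.union_comm, Finset.union_compl]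
  rw [lintegral_eq_lmarginal_univ x, h, lmarginal_union σ f hf disjoint_compl_left]

omit [Fintype ι] in
theorem lmarginal_const_mul_of_dependsOn (σ : ι → Measure ℝ) (B : Finset ι)
    {f g : (ι → ℝ) → ℝ≥0∞} (hg : Measurable g)
    (hf : ∀ φ ψ : ι → ℝ, (∀ i ∉ B, φ i = ψ i) → f φ = f ψ) (x : ι → ℝ) :
    lmarginal σ B (fun φ => g φ * f φ) x = lmarginal σ B g x * f x := by
  have h : ∀ y : (∀ _ : B, ℝ), f (Function.updateFinset x B y) = f x := fun y =>
    hf _ _ fun i hi => by simp [Function.updateFinset, hi]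
  simp only [lmarginal, h]
  exact lintegral_mul_const _ (hg.comp measurable_updateFinset)

/-- A function of the spins in `B` is independent of a function integrated over `B`. -/
theorem lintegral_mul_lmarginal (σ : ι → Measure ℝ) [∀ i, IsProbabilityMeasure (σ i)]
    (B : Finset ι) {f g : (ι → ℝ) → ℝ≥0∞} (hf : Measurable f) (hg : Measurable g)
    (hgB : ∀ φ ψ : ι → ℝ, (∀ i ∈ B, φ i = ψ i) → g φ = g ψ) :
    ∫⁻ φ, g φ * lmarginal σ B f φ ∂Measure.pi σ =
      (∫⁻ φ, g φ ∂Measure.pi σ) * ∫⁻ φ, f φ ∂Measure.pi σ := by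
  set x : ι → ℝ := fun _ => 0
  have hconst : lmarginal σ B g = fun _ => lmarginal σ B g x := by
    funext y
    refine lintegral_congr fun z => hgB _ _ fun i hi => by simp [Function.updateFinset, hi]
  have hg' : ∫⁻ φ, g φ ∂Measure.pi σ = lmarginal σ B g x := by
    rw [lintegral_eq_lmarginal_compl σ B hg x, hconst]
    simp [lmarginal]
  have hm : Measurable fun φ => g φ * lmarginal σ B f φ := hg.mul (hf.lmarginal σ)
  rw [lintegral_eq_lmarginal_compl σ B hm x, hg',
    lintegral_eq_lmarginal_compl σ B hf x]
  have : (lmarginal σ B fun φ => g φ * lmarginal σ B f φ) =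
      fun y => lmarginal σ B g x * lmarginal σ B f y := by
    funext y
    rw [lmarginal_const_mul_of_dependsOn σ B hg (fun φ ψ h => lmarginal_congr σ f h), hconst]
  rw [this]
  exact lintegral_const_mul _ ((hf.lmarginal σ).comp measurable_updateFinset)

/-- If a weight is dominated by its averages over sets of spins that contain `S`, then the
spins in `S` have a bounded density under that weight. -/
theorem setLIntegral_le_of_le_sum_lmarginal (σ : ι → Measure ℝ)
    [∀ i, IsProbabilityMeasure (σ i)] (S : Finset ι) {W : (ι → ℝ) → ℝ≥0∞} (hW : Measurable W)
    (K : ℝ≥0∞) (D : Finset ι → ℝ≥0∞)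
    (h : ∀ φ, W φ ≤ K * ∑ B ∈ Sᶜ.powerset, D B * lmarginal σ (S ∪ B) W φ)
    {E : Set (ι → ℝ)} (hE : MeasurableSet E)
    (hES : ∀ φ ψ : ι → ℝ, (∀ i ∈ S, φ i = ψ i) → (φ ∈ E ↔ ψ ∈ E)) :
    ∫⁻ φ in E, W φ ∂Measure.pi σ ≤
      K * (∑ B ∈ Sᶜ.powerset, D B) * (Measure.pi σ E * ∫⁻ φ, W φ ∂Measure.pi σ) := by
  calc ∫⁻ φ in E, W φ ∂Measure.pi σ
      ≤ ∫⁻ φ in E, K * ∑ B ∈ Sᶜ.powerset, D B * lmarginal σ (S ∪ B) W φ ∂Measure.pi σ :=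
        lintegral_mono h
    _ = K * ∑ B ∈ Sᶜ.powerset, D B * ∫⁻ φ in E, lmarginal σ (S ∪ B) W φ ∂Measure.pi σ := by
        rw [lintegral_const_mul _ (Finset.measurable_sum _ fun B _ => (hW.lmarginal σ).const_mul _),
          lintegral_finsetSum _ fun B _ => (hW.lmarginal σ).const_mul _]
        simp_rw [lintegral_const_mul _ (hW.lmarginal σ)]
    _ = K * (∑ B ∈ Sᶜ.powerset, D B) * (Measure.pi σ E * ∫⁻ φ, W φ ∂Measure.pi σ) := by
        rw [mul_assoc, Finset.sum_mul]
        congr 1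
        refine Finset.sum_congr rfl fun B _ => ?_
        congr 1
        rw [← lintegral_indicator_one hE, ← lintegral_mul_lmarginal σ (S ∪ B) hW
          (measurable_one.indicator hE), ← lintegral_indicator hE]
        · refine lintegral_congr fun φ => ?_
          by_cases hφ : φ ∈ E <;> simp [hφ]
        · intro φ ψ hφψ
          have := hES φ ψ fun i hi => hφψ i (Finset.mem_union_left _ hi)
          by_cases hφ : φ ∈ E
          · simp [hφ, this.1 hφ]
          · simp [hφ, mt this.2 hφ]

end Marginals

section Energy

variable {ι : Type*} [Fintype ι]

/-- The quadratic energy `1 / 2 ∑ k_{x, y} φ_x φ_y + ∑ h_x φ_x`. -/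
def energy (k : ι → ι → ℝ) (h φ : ι → ℝ) : ℝ :=
  1 / 2 * ∑ x, ∑ y, k x y * φ x * φ y + ∑ x, h x * φ x

variable [DecidableEq ι]

theorem energy_sub_energy {k : ι → ι → ℝ} (hk : ∀ x y, k x y = k y x) (h : ι → ℝ)
    {φ θ : ι → ℝ} {B : Finset ι} (hθ : ∀ x ∉ B, θ x = φ x) :
    energy k h φ - energy k h θ =
      1 / 2 * ∑ x ∈ B, ∑ y ∈ B, k x y * (φ x * φ y - θ x * θ y) +
        ∑ x ∈ B, (φ x - θ x) * (∑ y ∈ Bᶜ, k x y * φ y + h x) := by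
  have hθ' : ∀ x ∈ Bᶜ, θ x = φ x := fun x hx => hθ x (Finset.mem_compl.1 hx)
  have h1 : ∑ x, ∑ y, k x y * φ x * φ y - ∑ x, ∑ y, k x y * θ x * θ y =
      ∑ x, ∑ y, k x y * (φ x * φ y - θ x * θ y) := by
    simp_rw [← Finset.sum_sub_distrib]
    exact Finset.sum_congr rfl fun x _ => Finset.sum_congr rfl fun y _ => by ring
  have h2 : ∑ x, h x * φ x - ∑ x, h x * θ x = ∑ x ∈ B, (φ x - θ x) * h x := by
    rw [← Finset.sum_sub_distrib, ← Finset.sum_add_sum_compl B]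
    rw [Finset.sum_eq_zero (s := Bᶜ) fun x hx => by rw [hθ' x hx]; ring, add_zero]
    exact Finset.sum_congr rfl fun x _ => by ring
  have h3 : ∑ x ∈ B, ∑ y ∈ Bᶜ, k x y * (φ x * φ y - θ x * θ y) =
      ∑ x ∈ B, (φ x - θ x) * ∑ y ∈ Bᶜ, k x y * φ y := by
    refine Finset.sum_congr rfl fun x _ => ?_
    rw [Finset.mul_sum]
    exact Finset.sum_congr rfl fun y hy => by rw [hθ' y hy]; ring
  have h4 : ∑ x ∈ Bᶜ, ∑ y ∈ B, k x y * (φ x * φ y - θ x * θ y) =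
      ∑ x ∈ B, (φ x - θ x) * ∑ y ∈ Bᶜ, k x y * φ y := by
    rw [← h3, Finset.sum_comm]
    exact Finset.sum_congr rfl fun x _ => Finset.sum_congr rfl fun y _ => by
      rw [hk y x, mul_comm (φ y), mul_comm (θ y)]
  have h5 : ∑ x ∈ Bᶜ, ∑ y ∈ Bᶜ, k x y * (φ x * φ y - θ x * θ y) = 0 :=
    Finset.sum_eq_zero fun x hx => Finset.sum_eq_zero fun y hy => by
      rw [hθ' x hx, hθ' y hy]; ring
  have h6 : ∑ x, ∑ y, k x y * (φ x * φ y - θ x * θ y) =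
      ∑ x ∈ B, ∑ y ∈ B, k x y * (φ x * φ y - θ x * θ y) +
        2 * ∑ x ∈ B, (φ x - θ x) * ∑ y ∈ Bᶜ, k x y * φ y := by
    rw [← Finset.sum_add_sum_compl B]
    simp_rw [← Finset.sum_add_sum_compl B (fun y => k _ y * (φ _ * φ y - θ _ * θ y)),
      Finset.sum_add_distrib]
    rw [h3, h4, h5]; ring
  simp_rw [mul_add, Finset.sum_add_distrib]
  unfold energy
  linear_combination (1 / 2 : ℝ) * h1 + h2 + (1 / 2 : ℝ) * h6

theorem energy_sub_energy_le {k : ι → ι → ℝ} (hk : ∀ x y, k x y = k y x) (h : ι → ℝ)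
    {φ θ : ι → ℝ} {B : Finset ι} (hθ : ∀ x ∉ B, θ x = φ x) {K M : ℝ}
    (hK : ∀ x ∈ B, |θ x| ≤ K) (o X : ι → ℝ)
    (ho : ∀ x ∈ B, ∑ y ∈ B, |k x y| + o x ≤ M)
    (hX : ∀ x ∈ B, 1 / 2 * (φ x ^ 2 + K ^ 2) ≤ X x)
    (hoX : ∀ x ∈ B, (|φ x| + K) * |∑ y ∈ Bᶜ, k x y * φ y + h x| ≤ o x * X x) :
    energy k h φ - energy k h θ ≤ ∑ x ∈ B, M * X x := by
  have habs : ∀ x ∈ B, ∀ y ∈ B, k x y * (φ x * φ y - θ x * θ y) ≤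
      1 / 2 * (|k x y| * (φ x ^ 2 + K ^ 2)) + 1 / 2 * (|k x y| * (φ y ^ 2 + K ^ 2)) := by
    intro x hx y hy
    have h1 : |φ x * φ y| ≤ 1 / 2 * (φ x ^ 2 + φ y ^ 2) := by
      rw [abs_le]; constructor <;> nlinarith [sq_nonneg (φ x - φ y), sq_nonneg (φ x + φ y)]
    have h2 : |θ x * θ y| ≤ K ^ 2 := by
      rw [abs_mul, sq]
      exact mul_le_mul (hK x hx) (hK y hy) (abs_nonneg _) ((abs_nonneg _).trans (hK x hx))
    calc k x y * (φ x * φ y - θ x * θ y) ≤ |k x y| * |φ x * φ y - θ x * θ y| := by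
          rw [← abs_mul]; exact le_abs_self _
      _ ≤ |k x y| * (1 / 2 * (φ x ^ 2 + φ y ^ 2) + K ^ 2) := by
          gcongr
          exact (abs_sub _ _).trans (add_le_add h1 h2)
      _ = _ := by ring
  have hsum : ∑ x ∈ B, ∑ y ∈ B, k x y * (φ x * φ y - θ x * θ y) ≤
      ∑ x ∈ B, (∑ y ∈ B, |k x y|) * (φ x ^ 2 + K ^ 2) := by
    refine (Finset.sum_le_sum fun x hx => Finset.sum_le_sum fun y hy => habs x hx y hy).trans
      (le_of_eq ?_)
    simp_rw [Finset.sum_add_distrib, Finset.sum_mul]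
    rw [Finset.sum_comm (f := fun x y => 1 / 2 * (|k x y| * (φ y ^ 2 + K ^ 2)))]
    simp_rw [← Finset.sum_add_distrib]
    refine Finset.sum_congr rfl fun x _ => Finset.sum_congr rfl fun y _ => ?_
    rw [hk y x]; ring
  rw [energy_sub_energy hk h hθ]
  calc _ ≤ 1 / 2 * ∑ x ∈ B, (∑ y ∈ B, |k x y|) * (φ x ^ 2 + K ^ 2) + ∑ x ∈ B, o x * X x := by
        gcongr 1 / 2 * ?_ + ?_
        refine Finset.sum_le_sum fun x hx => le_trans ?_ (hoX x hx)
        refine (le_abs_self _).trans ?_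
        rw [abs_mul]
        gcongr
        exact (abs_sub _ _).trans (add_le_add le_rfl (hK x hx))
    _ ≤ ∑ x ∈ B, M * X x := by
        rw [Finset.mul_sum, ← Finset.sum_add_distrib]
        refine Finset.sum_le_sum fun x hx => ?_
        have h0 : 0 ≤ ∑ y ∈ B, |k x y| := Finset.sum_nonneg fun _ _ => abs_nonneg _
        have hX0 : 0 ≤ X x := le_trans (by positivity) (hX x hx)
        have h1 := mul_le_mul_of_nonneg_left (hX x hx) h0
        have h2 := mul_le_mul_of_nonneg_right (ho x hx) hX0
        linarith

end Energy

section Exploration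

variable {ι : Type*}

/-- The thresholds of the vertices explored from `S`: a vertex `x` of `S` has threshold `T x`, and
the exploration goes on from `z` to `y` if `|φ y|` exceeds `lam * f (J z y)` times a threshold
of `z`. -/
inductive Threshold (J : ι → ι → ℝ) (f : ℝ → ℝ) (lam : ℝ) (T : ι → ℝ) (S : Finset ι)
    (φ : ι → ℝ) : ι → ℝ → Prop
  | base {x : ι} : x ∈ S → Threshold J f lam T S φ x (T x)
  | step {z y : ι} {t : ℝ} : Threshold J f lam T S φ z t → J z y ≠ 0 →
      lam * t * f (J z y) < |φ y| → Threshold J f lam T S φ y (lam * t * f (J z y))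

variable {J : ι → ι → ℝ} {f : ℝ → ℝ} {lam : ℝ} {T : ι → ℝ} {S : Finset ι} {φ : ι → ℝ}

theorem Threshold.le {C : ℝ} (hC : 0 ≤ C) (hlam : 1 ≤ lam) (hf : ∀ s, 1 ≤ f s)
    (hT : ∀ x ∈ S, C ≤ T x) {y : ι} {t : ℝ} (h : Threshold J f lam T S φ y t) : C ≤ t := by
  induction h with
  | base hx => exact hT _ hx
  | @step z y t _ _ _ ih =>
    calc C ≤ t := ih
      _ ≤ lam * t := le_mul_of_one_le_left (hC.trans ih) hlam
      _ ≤ lam * t * f (J z y) :=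
        le_mul_of_one_le_right (mul_nonneg (zero_le_one.trans hlam) (hC.trans ih)) (hf _)

theorem Threshold.lt_abs {y : ι} {t : ℝ} (h : Threshold J f lam T S φ y t) (hy : y ∉ S) :
    t < |φ y| := by
  cases h with
  | base hx => exact absurd hx hy
  | step _ _ h => exact h

theorem Threshold.reachedFrom {C : ℝ} (hC : 0 ≤ C) (hlam : 1 ≤ lam) (hf : ∀ s, 1 ≤ f s)
    (hT : ∀ x ∈ S, C ≤ T x) {B : Finset ι}
    (hB : ∀ y t, Threshold J f lam T S φ y t → y ∉ S → y ∈ B)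
    {y : ι} {t : ℝ} (h : Threshold J f lam T S φ y t) :
    ReachedFrom (fun z y => J z y ≠ 0 ∧ C * f (J z y) < |φ y|) S B y := by
  induction h with
  | base hx => exact .base hx
  | @step z y t hz hJ hlt ih =>
    by_cases hy : y ∈ S
    · exact .base hy
    · refine .step ih (hB _ _ (.step hz hJ hlt) hy) ⟨hJ, lt_of_le_of_lt ?_ hlt⟩
      have hCt := hz.le hC hlam hf hT
      have := hf (J z y)
      gcongr
      exact hCt.trans (le_mul_of_one_le_left (hC.trans hCt) hlam)

theorem ReachedFrom.mono {r r' : ι → ι → Prop} {S B : Finset ι}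
    (hr : ∀ z, ∀ y ∈ B, r z y → r' z y) {y : ι} (h : ReachedFrom r S B y) :
    ReachedFrom r' S B y := by
  induction h with
  | base h => exact .base h
  | step _ hy hzy ih => exact .step ih hy (hr _ _ hy hzy)

variable [Fintype ι] [DecidableEq ι]

/-- Replacing the spins of the explored set by bounded spins costs a factor for every vertex of
`S`, and gains a Gaussian factor for every other explored vertex. -/
theorem exists_explored_set {k : ι → ι → ℝ} (hk : ∀ x y, k x y = k y x)
    (hkJ : ∀ x y, |k x y| ≤ |J x y|) (h o : ι → ℝ) {β M a K C : ℝ} (hβ : 0 ≤ β)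
    (hC : 0 ≤ C) (hK : 0 ≤ K) (hM : 0 ≤ M)
    (hlam : 1 ≤ lam) (ha : lam * (4 * β * M) ≤ a) (hf : ∀ s, 1 ≤ f s)
    (hT : ∀ x ∈ S, C ≤ T x)
    (ho0 : ∀ x, 0 ≤ o x) (ho : ∀ x, ∑ y, |J x y| * f (J x y) + o x ≤ M)
    (hh : ∀ y t, Threshold J f lam T S φ y t → |h y| ≤ o y * (lam * t)) :
    ∃ B : Finset ι, Disjoint S B ∧
      (∀ y ∈ B, ReachedFrom (fun z y => J z y ≠ 0 ∧ C * f (J z y) < |φ y|) S B y) ∧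
      ∀ θ : ι → ℝ, (∀ x ∉ S ∪ B, θ x = φ x) → (∀ x ∈ S ∪ B, |θ x| ≤ K) →
        β * energy k h φ - a / 2 * ∑ x, φ x ^ 2 ≤
          ∑ x ∈ S, (a * K ^ 2 + a / 4 * T x ^ 2) + ∑ y ∈ B, (a * K ^ 2 - a / 8 * φ y ^ 2) +
            (β * energy k h θ - a / 2 * ∑ x, θ x ^ 2) := by
  classical
  set B : Finset ι := Finset.univ.filter fun y => y ∉ S ∧ ∃ t, Threshold J f lam T S φ y t
    with hBdef
  have hmem : ∀ y t, Threshold J f lam T S φ y t → y ∉ S → y ∈ B := fun y t h hy => by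
    simp only [hBdef, Finset.mem_filter, Finset.mem_univ, true_and]
    exact ⟨hy, t, h⟩
  have hB : ∀ y ∈ B, y ∉ S ∧ ∃ t, Threshold J f lam T S φ y t := fun y hy => by
    simpa [hBdef] using hy
  have hdisj : Disjoint S B := Finset.disjoint_right.2 fun y hy => (hB y hy).1
  have ha0 : 0 ≤ a := le_trans (by positivity) ha
  have hlam0 : 0 ≤ lam := zero_le_one.trans hlam
  refine ⟨B, hdisj, fun y hy => ?_, fun θ hθ hθK => ?_⟩
  · obtain ⟨t, ht⟩ := (hB y hy).2
    exact ht.reachedFrom hC hlam hf hT hmem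
  set U := S ∪ B with hU
  set o' : ι → ℝ := fun x => ∑ y ∈ Uᶜ, |J x y| * f (J x y) + o x with ho'
  have hfield : ∀ y t, Threshold J f lam T S φ y t →
      |∑ z ∈ Uᶜ, k y z * φ z + h y| ≤ o' y * (lam * t) := by
    intro y t ht
    refine (abs_add_le _ _).trans ?_
    rw [ho', add_mul, Finset.sum_mul]
    refine add_le_add ((Finset.abs_sum_le_sum_abs _ _).trans
      (Finset.sum_le_sum fun z hz => ?_)) (hh y t ht)
    rw [abs_mul]
    by_cases hJ : J y z = 0
    · have : k y z = 0 := by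
        have := hkJ y z
        rw [hJ, abs_zero] at this
        exact abs_nonpos_iff.1 this
      simp [hJ, this]
    · have hz' : |φ z| ≤ lam * t * f (J y z) := by
        by_contra! hlt
        have hzt := Threshold.step ht hJ hlt
        rw [Finset.mem_compl, hU, Finset.mem_union, not_or] at hz
        exact hz.2 (hmem _ _ hzt hz.1)
      calc |k y z| * |φ z| ≤ |J y z| * (lam * t * f (J y z)) :=
            mul_le_mul (hkJ y z) hz' (abs_nonneg _) (abs_nonneg _)
        _ = _ := by ring
  have hJf : ∀ x y, 0 ≤ |J x y| * f (J x y) := fun x y =>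
    mul_nonneg (abs_nonneg _) (zero_le_one.trans (hf _))
  have ho'0 : ∀ y, 0 ≤ o' y := fun y => add_nonneg (Finset.sum_nonneg fun _ _ => hJf _ _) (ho0 y)
  set X : ι → ℝ := fun x => if x ∈ S then φ x ^ 2 + K ^ 2 + T x ^ 2 else
    φ x ^ 2 + K * |φ x| + K ^ 2 with hX
  have hXge : ∀ x, 1 / 2 * (φ x ^ 2 + K ^ 2) ≤ X x := by
    intro x
    have : 0 ≤ K * |φ x| := by positivity
    simp only [hX]
    split_ifs <;> nlinarith [sq_nonneg (φ x), sq_nonneg K, sq_nonneg (T x)]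
  have hX0 : ∀ x, 0 ≤ X x := fun x => le_trans (by positivity) (hXge x)
  have hfieldX : ∀ x ∈ U, (|φ x| + K) * |∑ y ∈ Uᶜ, k x y * φ y + h x| ≤ o' x * (lam * X x) := by
    intro x hx
    suffices H : ∃ t, Threshold J f lam T S φ x t ∧ (|φ x| + K) * t ≤ X x by
      obtain ⟨t, ht, hle⟩ := H
      calc (|φ x| + K) * |∑ y ∈ Uᶜ, k x y * φ y + h x| ≤ (|φ x| + K) * (o' x * (lam * t)) :=
            mul_le_mul_of_nonneg_left (hfield x t ht) (by positivity)
        _ = o' x * (lam * ((|φ x| + K) * t)) := by ring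
        _ ≤ o' x * (lam * X x) := by
            have := ho'0 x
            gcongr
    by_cases hxS : x ∈ S
    · refine ⟨T x, .base hxS, ?_⟩
      simp only [hX, if_pos hxS]
      nlinarith [sq_nonneg (|φ x| - T x), sq_nonneg (K - T x), sq_abs (φ x), sq_nonneg (φ x),
        sq_nonneg K]
    · obtain ⟨t, ht⟩ := (hB x ((Finset.mem_union.1 hx).resolve_left hxS)).2
      refine ⟨t, ht, ?_⟩
      simp only [hX, if_neg hxS]
      have h1 := mul_le_mul_of_nonneg_left (ht.lt_abs hxS).le
        (add_nonneg (abs_nonneg (φ x)) hK)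
      nlinarith [sq_abs (φ x), sq_nonneg K]
  have hmass : ∀ x ∈ U, ∑ y ∈ U, |k x y| + o' x ≤ M := by
    intro x _
    refine le_trans ?_ (ho x)
    rw [ho', ← add_assoc, ← Finset.sum_add_sum_compl U (fun y => |J x y| * f (J x y))]
    gcongr with y _
    exact (hkJ x y).trans (le_mul_of_one_le_right (abs_nonneg _) (hf _))
  have hE := energy_sub_energy_le hk h hθ hθK o' (fun x => lam * X x) hmass
    (fun x _ => (hXge x).trans (le_mul_of_one_le_left (hX0 x) hlam)) hfieldX
  have hE' : β * (energy k h φ - energy k h θ) ≤ ∑ x ∈ U, a / 4 * X x := by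
    refine (mul_le_mul_of_nonneg_left hE hβ).trans ?_
    rw [Finset.mul_sum]
    refine Finset.sum_le_sum fun x _ => ?_
    nlinarith [mul_le_mul_of_nonneg_right ha (hX0 x)]
  have hsq : ∑ x, φ x ^ 2 - ∑ x, θ x ^ 2 = ∑ x ∈ U, (φ x ^ 2 - θ x ^ 2) := by
    rw [← Finset.sum_sub_distrib, ← Finset.sum_add_sum_compl U]
    rw [Finset.sum_eq_zero (s := Uᶜ) fun x hx => by
      rw [hθ x (Finset.mem_compl.1 hx), sub_self], add_zero]
  have hterm : ∑ x ∈ U, (a / 4 * X x - a / 2 * (φ x ^ 2 - θ x ^ 2)) ≤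
      ∑ x ∈ S, (a * K ^ 2 + a / 4 * T x ^ 2) + ∑ y ∈ B, (a * K ^ 2 - a / 8 * φ y ^ 2) := by
    rw [Finset.sum_union hdisj]
    have hθ2 : ∀ x ∈ U, a * θ x ^ 2 ≤ a * K ^ 2 := fun x hx =>
      mul_le_mul_of_nonneg_left (sq_le_sq' (abs_le.1 (hθK x hx)).1 (abs_le.1 (hθK x hx)).2) ha0
    gcongr ∑ x ∈ S, ?_ + ∑ y ∈ B, ?_ with x hx x hx
    · have h1 := hθ2 x (Finset.mem_union_left _ hx)
      simp only [hX, if_pos hx]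
      nlinarith [mul_nonneg ha0 (sq_nonneg (φ x)), mul_nonneg ha0 (sq_nonneg K)]
    · have h1 := hθ2 x (Finset.mem_union_right _ hx)
      have h2 : a * (K * |φ x|) ≤ a * (φ x ^ 2 / 2 + K ^ 2 / 2) := by
        refine mul_le_mul_of_nonneg_left ?_ ha0
        nlinarith [sq_nonneg (|φ x| - K), sq_abs (φ x)]
      simp only [hX, if_neg (hB x hx).1]
      nlinarith [mul_nonneg ha0 (sq_nonneg K)]
  rw [Finset.sum_sub_distrib, ← Finset.mul_sum (f := fun x => φ x ^ 2 - θ x ^ 2), ← hsq] at hterm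
  linarith

end Exploration

section Constants

theorem exists_exp_neg_sq_le {a δ M L : ℝ} (ha : 0 < a) (hδ : 0 < δ) (hM : 0 < M) (hL : 0 < L) :
    ∃ C : ℝ, 1 ≤ C ∧ ∀ f : ℝ → ℝ, (∀ t, 1 ≤ f t) →
      (∀ t, t ≠ 0 → |t| < δ → √(Real.log |t|⁻¹) ≤ f t) →
      ∀ s u : ℝ, s ≠ 0 → C * f s < |u| → L * Real.exp (-(a / 8 * u ^ 2)) ≤ |s| / (4 * M) := by
  set Q : ℝ := 4 * M * L * (1 + 1 / δ) with hQ
  have hQ0 : 0 < Q := by positivity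
  set c : ℝ := 1 + max 0 (Real.log Q) with hc
  have hc1 : 1 ≤ c := by simp [hc]
  have hcexp : Q * Real.exp (-(c - 1)) ≤ 1 := by
    have h1 : Q ≤ Real.exp (c - 1) := by
      rw [← Real.log_le_iff_le_exp hQ0, hc, add_sub_cancel_left]
      exact le_max_right _ _
    rw [Real.exp_neg]
    exact (mul_inv_le_iff₀ (Real.exp_pos _)).2 (by simpa using h1)
  have hC1 : 1 ≤ 1 + 8 * c / a := by
    have : 0 ≤ 8 * c / a := by positivity
    linarith
  refine ⟨1 + 8 * c / a, hC1, fun f hf1 hf s u hs hu => ?_⟩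
  set C : ℝ := 1 + 8 * c / a with hC
  have hfs := hf1 s
  have hs0 : 0 < |s| := abs_pos.2 hs
  have hu2 : c * f s ^ 2 ≤ a / 8 * u ^ 2 := by
    have h1 : (C * f s) ^ 2 ≤ u ^ 2 := by
      rw [← sq_abs u]
      gcongr
    have h2 : c ≤ a / 8 * C ^ 2 := by
      have h3 : a / 8 * C = a / 8 + c := by rw [hC]; field_simp
      nlinarith
    calc c * f s ^ 2 ≤ a / 8 * C ^ 2 * f s ^ 2 := by gcongr
      _ = a / 8 * (C * f s) ^ 2 := by ring
      _ ≤ a / 8 * u ^ 2 := by gcongr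
  have hf2 : 1 ≤ f s ^ 2 := one_le_pow₀ hfs
  have hexp : Real.exp (-(f s ^ 2)) ≤ |s| * (1 + 1 / δ) := by
    by_cases hsδ : |s| < δ
    · have h1 : Real.log |s|⁻¹ ≤ f s ^ 2 := by
        have := hf s hs hsδ
        exact (Real.sqrt_le_left (by linarith)).1 this
      rw [Real.log_inv] at h1
      calc Real.exp (-(f s ^ 2)) ≤ Real.exp (Real.log |s|) := Real.exp_le_exp.2 (by linarith)
        _ = |s| := Real.exp_log hs0
        _ ≤ |s| * (1 + 1 / δ) := le_mul_of_one_le_right hs0.le (by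
            have : 0 < 1 / δ := by positivity
            linarith)
    · push Not at hsδ
      calc Real.exp (-(f s ^ 2)) ≤ 1 := Real.exp_le_one_iff.2 (by linarith)
        _ ≤ |s| / δ := (one_le_div hδ).2 hsδ
        _ ≤ |s| * (1 + 1 / δ) := by rw [mul_add, mul_one_div]; linarith
  calc L * Real.exp (-(a / 8 * u ^ 2)) ≤ L * (Real.exp (-(c - 1)) * Real.exp (-(f s ^ 2))) := by
        rw [← Real.exp_add]
        gcongr
        nlinarith
    _ ≤ L * (Real.exp (-(c - 1)) * (|s| * (1 + 1 / δ))) := by gcongr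
    _ = Q * Real.exp (-(c - 1)) * (|s| / (4 * M)) := by rw [hQ]; field_simp
    _ ≤ 1 * (|s| / (4 * M)) := by gcongr
    _ = |s| / (4 * M) := one_mul _

theorem prod_one_add_two_mul_ofReal_le {ι : Type*} (U : Finset ι) (v : ι → ℝ) {M : ℝ} (hM : 0 < M)
    (hv0 : ∀ y, 0 ≤ v y) (hv : ∑ y ∈ U, v y ≤ M) :
    ∏ y ∈ U, (1 + 2 * ENNReal.ofReal (v y / (4 * M))) ≤ 2 := by
  have h1 : ∀ y ∈ U, 1 + 2 * ENNReal.ofReal (v y / (4 * M)) ≤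
      ENNReal.ofReal (Real.exp (v y / (2 * M))) := by
    intro y _
    have hy : 0 ≤ v y / (4 * M) := div_nonneg (hv0 y) (by positivity)
    have : 1 + 2 * ENNReal.ofReal (v y / (4 * M)) = ENNReal.ofReal (1 + 2 * (v y / (4 * M))) := by
      rw [ENNReal.ofReal_add zero_le_one (by positivity), ENNReal.ofReal_mul zero_le_two]
      simp
    rw [this]
    refine ENNReal.ofReal_le_ofReal ?_
    have := Real.add_one_le_exp (v y / (2 * M))
    calc 1 + 2 * (v y / (4 * M)) = v y / (2 * M) + 1 := by field_simp; ring
      _ ≤ _ := this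
  refine (Finset.prod_le_prod' h1).trans ?_
  rw [← ENNReal.ofReal_prod_of_nonneg fun _ _ => (Real.exp_pos _).le, ← Real.exp_sum,
    ← Finset.sum_div]
  have h2 : Real.exp ((∑ y ∈ U, v y) / (2 * M)) ≤ 2 := by
    have h3 : (∑ y ∈ U, v y) / (2 * M) ≤ 1 / 2 := by
      rw [div_le_div_iff₀ (by positivity) two_pos]
      linarith
    have h4 : Real.exp (1 / 2) ^ 2 = Real.exp 1 := by
      rw [← Real.exp_nat_mul]; norm_num
    have h5 := Real.exp_one_lt_d9
    refine (Real.exp_le_exp.2 h3).trans ?_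
    nlinarith [Real.exp_pos (1 / 2)]
  calc ENNReal.ofReal _ ≤ ENNReal.ofReal 2 := ENNReal.ofReal_le_ofReal h2
    _ = 2 := by simp

end Constants

section Domination

variable {ι : Type*} [Fintype ι]

/-- The Gibbs weight with respect to the product of the tilted measures. -/
def tiltedWeight (β a : ℝ) (k : ι → ι → ℝ) (h φ : ι → ℝ) : ℝ≥0∞ :=
  ENNReal.ofReal (Real.exp (β * energy k h φ - a / 2 * ∑ x, φ x ^ 2))

theorem measurable_energy (k : ι → ι → ℝ) (h : ι → ℝ) : Measurable (energy k h) := by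
  unfold energy
  fun_prop

theorem measurable_tiltedWeight (β a : ℝ) (k : ι → ι → ℝ) (h : ι → ℝ) :
    Measurable (tiltedWeight β a k h) := by
  have := measurable_energy k h
  unfold tiltedWeight
  fun_prop

variable [DecidableEq ι]

theorem mul_pow_le_lmarginal (σ : Measure ℝ) [IsProbabilityMeasure σ] (U : Finset ι) {K : ℝ}
    {W : (ι → ℝ) → ℝ≥0∞} (hW : Measurable W) {c F : ℝ≥0∞} {φ : ι → ℝ}
    (h : ∀ θ : ι → ℝ, (∀ x ∉ U, θ x = φ x) → (∀ x ∈ U, |θ x| ≤ K) → c ≤ F * W θ) :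
    c * σ (Set.Icc (-K) K) ^ U.card ≤ F * lmarginal (fun _ => σ) U W φ := by
  set Q : Set (U → ℝ) := Set.univ.pi fun _ => Set.Icc (-K) K with hQ
  have hQm : MeasurableSet Q := MeasurableSet.univ_pi fun _ => measurableSet_Icc
  have hWm : Measurable fun y : U → ℝ => W (Function.updateFinset φ U y) :=
    hW.comp measurable_updateFinset
  calc c * σ (Set.Icc (-K) K) ^ U.card
      = ∫⁻ _ in Q, c ∂Measure.pi fun _ : U => σ := by
        rw [setLIntegral_const, hQ, Measure.pi_pi]
        simp
    _ ≤ ∫⁻ y in Q, F * W (Function.updateFinset φ U y) ∂Measure.pi fun _ : U => σ := by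
        refine setLIntegral_mono (hWm.const_mul F) fun y hy => h _ (fun x hx => ?_) fun x hx => ?_
        · simp [Function.updateFinset, hx]
        · simpa [Function.updateFinset, hx, abs_le] using hy ⟨x, hx⟩ trivial
    _ ≤ ∫⁻ y, F * W (Function.updateFinset φ U y) ∂Measure.pi fun _ : U => σ :=
        setLIntegral_le_lintegral _ _
    _ = F * lmarginal (fun _ => σ) U W φ := lintegral_const_mul _ hWm

theorem setLIntegral_tiltedWeight_le {J k : ι → ι → ℝ} {f : ℝ → ℝ} {lam : ℝ} {T : ι → ℝ}
    {S : Finset ι} (hk : ∀ x y, k x y = k y x)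
    (hkJ : ∀ x y, |k x y| ≤ |J x y|) (h o : ι → ℝ) {β M a K C : ℝ} (hβ : 0 ≤ β)
    (hC : 0 ≤ C) (hK : 0 ≤ K) (hM : 0 < M)
    (hlam : 1 ≤ lam) (ha : lam * (4 * β * M) ≤ a) (hf : ∀ s, 1 ≤ f s)
    (hT : ∀ x ∈ S, C ≤ T x)
    (ho0 : ∀ x, 0 ≤ o x) (ho : ∀ x, ∑ y, |J x y| * f (J x y) + o x ≤ M)
    (hh : ∀ φ y t, Threshold J f lam T S φ y t → |h y| ≤ o y * (lam * t))
    (σ : Measure ℝ) [IsProbabilityMeasure σ] {p : ℝ} (hp : 0 < p)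
    (hσ : σ (Set.Icc (-K) K) = ENNReal.ofReal p)
    (hCf : ∀ s u : ℝ, s ≠ 0 → C * f s < |u| →
      Real.exp (a * K ^ 2) / p * Real.exp (-(a / 8 * u ^ 2)) ≤ |s| / (4 * M))
    {E : Set (ι → ℝ)} (hE : MeasurableSet E)
    (hES : ∀ φ ψ : ι → ℝ, (∀ i ∈ S, φ i = ψ i) → (φ ∈ E ↔ ψ ∈ E)) :
    ∫⁻ φ in E, tiltedWeight β a k h φ ∂Measure.pi (fun _ => σ) ≤
      (∏ x ∈ S, ENNReal.ofReal (2 * (Real.exp (a * K ^ 2) / p) * Real.exp (a / 4 * T x ^ 2))) *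
        (Measure.pi (fun _ => σ) E * ∫⁻ φ, tiltedWeight β a k h φ ∂Measure.pi (fun _ => σ)) := by
  set L : ℝ := Real.exp (a * K ^ 2) / p with hL
  have hL0 : 0 < L := by positivity
  set w : ι → ι → ℝ≥0∞ := fun z y => ENNReal.ofReal (|J z y| / (4 * M)) with hw
  have hw2 : ∀ x, ∀ U : Finset ι, ∏ y ∈ U, (1 + 2 * w x y) ≤ 2 := by
    intro x U
    refine prod_one_add_two_mul_ofReal_le U (fun y => |J x y|) hM (fun _ => abs_nonneg _) ?_
    calc ∑ y ∈ U, |J x y| ≤ ∑ y, |J x y| :=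
          Finset.sum_le_univ_sum_of_nonneg fun _ => abs_nonneg _
      _ ≤ ∑ y, |J x y| * f (J x y) := Finset.sum_le_sum fun y _ =>
          le_mul_of_one_le_right (abs_nonneg _) (hf _)
      _ ≤ M := by linarith [ho x, ho0 x]
  have hpow : ∑ B ∈ Sᶜ.powerset, forestBound w S B ≤ 2 ^ S.card :=
    sum_forestBound_le w S Sᶜ disjoint_compl_right hw2
  have hpt : ∀ φ, tiltedWeight β a k h φ ≤
      (∏ x ∈ S, ENNReal.ofReal (L * Real.exp (a / 4 * T x ^ 2))) *
        ∑ B ∈ Sᶜ.powerset, forestBound w S B *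
          lmarginal (fun _ => σ) (S ∪ B) (tiltedWeight β a k h) φ := by
    intro φ
    obtain ⟨B, hSB, hreach, hcost⟩ := exists_explored_set hk hkJ h o hβ hC hK hM.le hlam ha hf hT
      ho0 ho (hh φ)
    set q : ι → ℝ≥0∞ := fun y => ENNReal.ofReal (L * Real.exp (-(a / 8 * φ y ^ 2))) with hq
    have hqB : ∏ y ∈ B, q y ≤ forestBound w S B :=
      prod_le_forestBound fun y hy => (hreach y hy).mono fun z y _ hzy =>
        ENNReal.ofReal_le_ofReal (hCf _ _ hzy.1 hzy.2)
    set F : ℝ := Real.exp (∑ x ∈ S, (a * K ^ 2 + a / 4 * T x ^ 2) +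
      ∑ y ∈ B, (a * K ^ 2 - a / 8 * φ y ^ 2)) with hF
    have hmain := mul_pow_le_lmarginal σ (S ∪ B) (K := K) (φ := φ) (F := ENNReal.ofReal F)
      (measurable_tiltedWeight β a k h) (c := tiltedWeight β a k h φ) fun θ h1 h2 => by
        rw [tiltedWeight, tiltedWeight, ← ENNReal.ofReal_mul (Real.exp_pos _).le,
          ← Real.exp_add]
        exact ENNReal.ofReal_le_ofReal (Real.exp_le_exp.2 (hcost θ h1 h2))
    have hFeq : ENNReal.ofReal F =
        (∏ x ∈ S, ENNReal.ofReal (L * Real.exp (a / 4 * T x ^ 2))) * (∏ y ∈ B, q y) *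
          ENNReal.ofReal p ^ (S ∪ B).card := by
      rw [Finset.card_union_of_disjoint hSB, hF, Real.exp_add, Real.exp_sum, Real.exp_sum,
        ENNReal.ofReal_mul (by positivity),
        ENNReal.ofReal_prod_of_nonneg fun _ _ => (Real.exp_pos _).le,
        ENNReal.ofReal_prod_of_nonneg fun _ _ => (Real.exp_pos _).le, pow_add,
        mul_mul_mul_comm, ← Finset.prod_const, ← Finset.prod_const, ← Finset.prod_mul_distrib,
        ← Finset.prod_mul_distrib]
      congr 1
      · refine Finset.prod_congr rfl fun x _ => ?_
        rw [← ENNReal.ofReal_mul (by positivity), Real.exp_add, hL]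
        congr 1
        field_simp
      · refine Finset.prod_congr rfl fun x _ => ?_
        rw [hq, ← ENNReal.ofReal_mul (by positivity), sub_eq_add_neg, Real.exp_add, hL]
        congr 1
        field_simp
    rw [hσ, hFeq, mul_right_comm] at hmain
    have hp0 : ENNReal.ofReal p ^ (S ∪ B).card ≠ 0 := by simp [hp]
    have hpt : ENNReal.ofReal p ^ (S ∪ B).card ≠ ∞ := by simp
    refine ((ENNReal.mul_le_mul_iff_left hp0 hpt).1 hmain).trans ?_
    rw [mul_assoc]
    refine mul_le_mul_right ((mul_le_mul_left hqB _).trans ?_) _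
    exact Finset.single_le_sum (f := fun B => forestBound w S B *
      lmarginal (fun _ => σ) (S ∪ B) (tiltedWeight β a k h) φ) (fun _ _ => zero_le)
      (Finset.mem_powerset.2 (Finset.subset_compl_iff_disjoint_left.2 hSB))
  refine (setLIntegral_le_of_le_sum_lmarginal (fun _ => σ) S (measurable_tiltedWeight β a k h) _ _
    hpt hE hES).trans ?_
  refine mul_le_mul_left ((mul_le_mul_right hpow _).trans (le_of_eq ?_)) _
  rw [mul_comm, ← Finset.prod_const, ← Finset.prod_mul_distrib]
  refine Finset.prod_congr rfl fun x _ => ?_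
  rw [mul_assoc, ENNReal.ofReal_mul zero_le_two]
  simp

/-- The weight is bounded as soon as the Gaussian part dominates the interaction. -/
theorem exists_tiltedWeight_le {k : ι → ι → ℝ} (hk : ∀ x y, k x y = k y x) (h : ι → ℝ)
    {β M a : ℝ} (hβ : 0 ≤ β) (hM : 0 < M) (ha : 4 * β * M ≤ a) (hkM : ∀ x, ∑ y, |k x y| ≤ M) :
    ∃ c : ℝ, ∀ φ, tiltedWeight β a k h φ ≤ ENNReal.ofReal c := by
  refine ⟨Real.exp (∑ x, β * h x ^ 2 / (2 * M)), fun φ => ?_⟩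
  refine ENNReal.ofReal_le_ofReal (Real.exp_le_exp.2 ?_)
  have h0 := energy_sub_energy_le hk 0 (φ := φ) (θ := 0) (B := Finset.univ) (K := 0) (M := M)
    (by simp) (by simp) 0 (fun x => 1 / 2 * φ x ^ 2) (by simpa using hkM) (by simp) (by simp)
  have h1 : energy k 0 (0 : ι → ℝ) = 0 := by simp [energy]
  have h2 : energy k h φ = energy k 0 φ + ∑ x, h x * φ x := by simp [energy]
  have h3 : energy k h φ ≤ ∑ x, (M * φ x ^ 2 + h x ^ 2 / (2 * M)) := by
    rw [h2]
    rw [h1, sub_zero] at h0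
    refine (add_le_add_left h0 _).trans ?_
    rw [← Finset.sum_add_distrib]
    refine Finset.sum_le_sum fun x _ => ?_
    have : h x * φ x ≤ M / 2 * φ x ^ 2 + h x ^ 2 / (2 * M) := by
      have h4 : M / 2 * φ x ^ 2 + h x ^ 2 / (2 * M) - h x * φ x =
          (M * φ x - h x) ^ 2 / (2 * M) := by field_simp; ring
      have h5 : 0 ≤ (M * φ x - h x) ^ 2 / (2 * M) := by positivity
      linarith
    linarith
  have h4 := mul_le_mul_of_nonneg_left h3 hβ
  rw [Finset.mul_sum] at h4
  have h5 : ∑ x, β * (M * φ x ^ 2 + h x ^ 2 / (2 * M)) ≤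
      ∑ x, (a / 2 * φ x ^ 2 + β * h x ^ 2 / (2 * M)) := by
    refine Finset.sum_le_sum fun x _ => ?_
    have h6 : β * M * φ x ^ 2 ≤ a / 2 * φ x ^ 2 := by
      have : 0 ≤ β * M := by positivity
      gcongr
      linarith
    rw [mul_div_assoc]
    linarith
  rw [Finset.sum_add_distrib, ← Finset.mul_sum (f := fun x => φ x ^ 2)] at h5
  linarith

end Domination

theorem pi_withDensity {ι : Type*} [Fintype ι] (σ : Measure ℝ) [IsProbabilityMeasure σ]
    {g : ℝ → ℝ≥0∞} (hg : Measurable g) [SigmaFinite (σ.withDensity g)] :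
    Measure.pi (fun _ : ι => σ.withDensity g) =
      (Measure.pi fun _ : ι => σ).withDensity fun φ => ∏ x, g (φ x) := by
  refine Measure.pi_eq fun s hs => ?_
  have hQ : MeasurableSet (Set.univ.pi s) := MeasurableSet.univ_pi hs
  rw [withDensity_apply _ hQ, ← lintegral_indicator hQ]
  have h1 : ∀ φ : ι → ℝ, (Set.univ.pi s).indicator (fun φ => ∏ x, g (φ x)) φ =
      ∏ x, (s x).indicator g (φ x) := by
    intro φ
    by_cases hφ : φ ∈ Set.univ.pi s
    · rw [Set.indicator_of_mem hφ]
      exact Finset.prod_congr rfl fun x _ => (Set.indicator_of_mem (hφ x trivial) _).symm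
    · rw [Set.indicator_of_notMem hφ]
      simp only [Set.mem_pi, Set.mem_univ, true_imp_iff, not_forall] at hφ
      obtain ⟨x, hx⟩ := hφ
      exact (Finset.prod_eq_zero (Finset.mem_univ x) (Set.indicator_of_notMem hx _)).symm
  simp_rw [h1]
  have hm : ∀ x, Measurable ((s x).indicator g) := fun x => hg.indicator (hs x)
  have hind := ProbabilityTheory.iIndepFun_pi (μ := fun _ : ι => σ)
    (X := fun x => (s x).indicator g) fun x => (hm x).aemeasurable
  rw [ProbabilityTheory.lintegral_prod_eq_prod_lintegral_of_indepFun Finset.univ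
    (fun x (φ : ι → ℝ) => (s x).indicator g (φ x)) hind
    fun x => (hm x).comp (measurable_pi_apply x)]
  refine Finset.prod_congr rfl fun x _ => ?_
  rw [withDensity_apply _ (hs x), ← lintegral_indicator (hs x)]
  exact (measurePreserving_eval (fun _ : ι => σ) x).lintegral_comp (hm x)

section Walks

variable {V : Type*} {J : V → V → ℝ} {f : ℝ → ℝ} {ξ : V → ℝ} {C lam : ℝ}

theorem Threshold.exists_walk {Λ : Finset V} {T : Λ → ℝ} {S : Finset Λ} {φ : Λ → ℝ} {y : Λ} {t : ℝ}
    (h : Threshold (fun x y : Λ => J x y) f lam T S φ y t) :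
    ∃ x ∈ S, ∃ (m : ℕ) (p : ℕ → V), IsWalk J (Λ : Set V) {(x : V)} (Λ : Set V) m p ∧ p m = y ∧
      t = T x * lam ^ m * ∏ i ∈ Finset.range m, f (J (p i) (p (i + 1))) := by
  induction h with
  | @base x hx =>
    refine ⟨x, hx, 0, fun _ => x, ⟨rfl, x.2, fun i h0 h1 => absurd h1 (by omega),
      fun i hi => absurd hi (by omega)⟩, rfl, by simp⟩
  | @step z y t _ hJ _ ih =>
    obtain ⟨x, hx, m, p, hp, hpm, rfl⟩ := ih
    set p' : ℕ → V := fun i => if i ≤ m then p i else y with hp'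
    have hle : ∀ i, i ≤ m → p' i = p i := fun i hi => by simp [hp', hi]
    have hlast : p' (m + 1) = y := by simp [hp']
    refine ⟨x, hx, m + 1, p', ⟨?_, ?_, fun i h0 hi => ?_, fun i hi => ?_⟩, hlast, ?_⟩
    · rw [hle 0 (Nat.zero_le _)]; exact hp.start_mem
    · rw [hlast]; exact y.2
    · rw [hle i (by omega)]
      obtain rfl | him := eq_or_ne i m
      · exact hp.end_mem
      · exact hp.mem i h0 (by omega)
    · obtain rfl | him := eq_or_ne i m
      · rw [hle i le_rfl, hlast, hpm]; exact hJ
      · rw [hle i (by omega), hle (i + 1) (by omega)]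
        exact hp.ne_zero i (by omega)
    · have hprod : ∏ i ∈ Finset.range m, f (J (p' i) (p' (i + 1))) =
          ∏ i ∈ Finset.range m, f (J (p i) (p (i + 1))) :=
        Finset.prod_congr rfl fun i hi => by
          rw [hle i (Finset.mem_range.1 hi).le, hle (i + 1) (Finset.mem_range.1 hi)]
      rw [Finset.prod_range_succ, hlast, hle m le_rfl, hpm, hprod]
      ring

theorem isClosed_boundaryCondition (R : Set V) (x : V) :
    IsClosed {A : ℝ | BoundaryCondition J f ξ C lam R x A} := by
  simp only [BoundaryCondition, Set.ofPred_forall]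
  refine isClosed_iInter fun m => isClosed_iInter fun p => isClosed_iInter fun _ => ?_
  exact isClosed_le continuous_const (by fun_prop)

/-- The infimum that defines the boundary function is attained. -/
theorem exists_boundaryFunction_eq {R : Set V} {x : V}
    (h : boundaryFunction J f ξ C lam R x ≠ ∞) :
    ∃ A : ℝ, 1 ≤ A ∧ BoundaryCondition J f ξ C lam R x A ∧
      boundaryFunction J f ξ C lam R x = ENNReal.ofReal A := by
  set s : Set ℝ := {A | 1 ≤ A} ∩ {A | BoundaryCondition J f ξ C lam R x A} with hs
  have hne : s.Nonempty := by
    by_contra hne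
    refine h ?_
    have : {b | ∃ A : ℝ, 1 ≤ A ∧ BoundaryCondition J f ξ C lam R x A ∧ b = ENNReal.ofReal A} =
        ∅ := by
      refine Set.eq_empty_of_forall_notMem ?_
      rintro b ⟨A, h1, h2, _⟩
      exact hne ⟨A, h1, h2⟩
    rw [boundaryFunction, this, sInf_empty]
  have hbdd : BddBelow s := ⟨1, fun A hA => hA.1⟩
  have hcl : IsClosed s := isClosed_Ici.inter (isClosed_boundaryCondition R x)
  have hmem := hcl.csInf_mem hne hbdd
  refine ⟨sInf s, hmem.1, hmem.2, le_antisymm (sInf_le ⟨_, hmem.1, hmem.2, rfl⟩) (le_sInf ?_)⟩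
  rintro b ⟨A, h1, h2, rfl⟩
  exact ENNReal.ofReal_le_ofReal (csInf_le hbdd ⟨h1, h2⟩)

theorem one_le_exp_mul_sq {C' : ℝ} (hC' : 0 < C') (b : ℝ≥0∞) :
    1 ≤ EReal.exp ((C' : EReal) * (b : EReal) ^ 2) := by
  rw [← EReal.exp_zero]
  refine EReal.exp_monotone (mul_nonneg (by exact_mod_cast hC'.le) ?_)
  rw [sq]
  exact mul_nonneg (EReal.coe_ennreal_nonneg _) (EReal.coe_ennreal_nonneg _)

theorem exp_mul_ofReal_sq {C' A : ℝ} (hA : 0 ≤ A) :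
    EReal.exp ((C' : EReal) * ((ENNReal.ofReal A : ℝ≥0∞) : EReal) ^ 2) =
      ENNReal.ofReal (Real.exp (C' * A ^ 2)) := by
  rw [EReal.coe_ennreal_ofReal, max_eq_left hA, ← EReal.exp_coe]
  norm_cast

theorem prod_exp_eq_top {C' : ℝ} (hC' : 0 < C') {Λ' : Finset V} {b : V → ℝ≥0∞} {x : V}
    (hx : x ∈ Λ') (hb : b x = ∞) :
    ∏ x ∈ Λ', EReal.exp ((C' : EReal) * (b x : EReal) ^ 2) = ∞ := by
  classical
  rw [← Finset.mul_prod_erase _ _ hx, hb, EReal.coe_ennreal_top, sq, EReal.top_mul_top,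
    EReal.coe_mul_top_of_pos hC', EReal.exp_top, ENNReal.top_mul]
  exact (zero_lt_one.trans_le (Finset.one_le_prod' fun y _ => one_le_exp_mul_sq hC' (b y))).ne'

end Walks

section Gibbs

variable {V : Type*}

open Classical in
/-- The interaction without its diagonal. -/
def offDiag {ι : Type*} (J : ι → ι → ℝ) (x y : ι) : ℝ := if x ≠ y then J x y else 0

theorem hamiltonian_eq_neg_energy (J : V → V → ℝ) (ξ : V → ℝ) (Λ : Finset V) (φ : Λ → ℝ) :
    hamiltonian J ξ Λ φ = -energy (offDiag fun x y : Λ => J x y)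
      (fun x : Λ => externalField J ξ (Λ : Set V) x) φ := by
  rw [energy, hamiltonian, neg_add, ← sub_eq_add_neg]
  congr 3
  refine Finset.sum_congr rfl fun x _ => Finset.sum_congr rfl fun y _ => ?_
  by_cases hxy : x = y <;> simp [offDiag, hxy]

variable {ρ σ : Measure ℝ} {a : ℝ} {m : ℝ≥0∞}

theorem gibbsWeight_eq [IsProbabilityMeasure σ] [SigmaFinite ρ]
    (hρ : ρ = σ.withDensity fun u => m * ENNReal.ofReal (Real.exp (-(a / 2 * u ^ 2))))
    (β : ℝ) (J : V → V → ℝ) (ξ : V → ℝ) (Λ : Finset V) :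
    gibbsWeight β ρ J ξ Λ = m ^ Λ.card • (Measure.pi fun _ : Λ => σ).withDensity
      (tiltedWeight β a (offDiag fun x y : Λ => J x y)
        fun x : Λ => externalField J ξ (Λ : Set V) x) := by
  have hg : Measurable fun u : ℝ => m * ENNReal.ofReal (Real.exp (-(a / 2 * u ^ 2))) := by
    fun_prop
  have hH : Measurable fun φ : Λ → ℝ => ENNReal.ofReal (Real.exp (-β * hamiltonian J ξ Λ φ)) := by
    simp_rw [hamiltonian_eq_neg_energy]
    have := measurable_energy (offDiag fun x y : Λ => J x y)
      (fun x : Λ => externalField J ξ (Λ : Set V) x)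
    fun_prop
  have : SigmaFinite (σ.withDensity fun u => m * ENNReal.ofReal (Real.exp (-(a / 2 * u ^ 2)))) :=
    hρ ▸ inferInstance
  have hpi : (Measure.pi fun _ : Λ => ρ) = (Measure.pi fun _ : Λ => σ).withDensity
      fun φ => ∏ x, (m * ENNReal.ofReal (Real.exp (-(a / 2 * φ x ^ 2)))) := by
    subst hρ
    exact pi_withDensity σ hg
  rw [gibbsWeight, hpi, ← withDensity_mul _ (by fun_prop) hH,
    ← withDensity_smul _ (measurable_tiltedWeight _ _ _ _)]
  congr 1
  funext φ
  simp only [Pi.mul_apply, Pi.smul_apply, smul_eq_mul, Finset.prod_mul_distrib, Finset.prod_const,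
    Finset.card_univ, Fintype.card_coe, mul_assoc]
  rw [← ENNReal.ofReal_prod_of_nonneg fun _ _ => (Real.exp_pos _).le, ← Real.exp_sum,
    ← ENNReal.ofReal_mul (Real.exp_pos _).le, ← Real.exp_add, hamiltonian_eq_neg_energy,
    tiltedWeight, Finset.mul_sum, Finset.sum_neg_distrib, neg_mul_neg, neg_add_eq_sub]

theorem gibbsMeasure_eq [IsProbabilityMeasure σ] [SigmaFinite ρ]
    (hρ : ρ = σ.withDensity fun u => m * ENNReal.ofReal (Real.exp (-(a / 2 * u ^ 2))))
    (hm0 : m ≠ 0) (hm : m ≠ ∞) (β : ℝ) (J : V → V → ℝ) (ξ : V → ℝ) (Λ : Finset V) :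
    gibbsMeasure β ρ J ξ Λ =
      (∫⁻ φ, tiltedWeight β a (offDiag fun x y : Λ => J x y)
        (fun x : Λ => externalField J ξ (Λ : Set V) x) φ ∂Measure.pi fun _ : Λ => σ)⁻¹ •
        (Measure.pi fun _ : Λ => σ).withDensity (tiltedWeight β a (offDiag fun x y : Λ => J x y)
          fun x : Λ => externalField J ξ (Λ : Set V) x) := by
  have hp0 : m ^ Λ.card ≠ 0 := pow_ne_zero _ hm0
  have hp : m ^ Λ.card ≠ ∞ := ENNReal.pow_ne_top hm
  rw [gibbsMeasure, partitionFunction, gibbsWeight_eq hρ, Measure.smul_apply,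
    withDensity_apply _ MeasurableSet.univ, setLIntegral_univ, smul_smul, smul_eq_mul,
    ENNReal.mul_inv (Or.inl hp0) (Or.inl hp), mul_right_comm, ENNReal.inv_mul_cancel hp0 hp,
    one_mul]

theorem lintegral_tiltedWeight_pos {ι : Type*} [Fintype ι] (σ : Measure ℝ)
    [IsProbabilityMeasure σ] (β a : ℝ) (k : ι → ι → ℝ) (h : ι → ℝ) :
    ∫⁻ φ, tiltedWeight β a k h φ ∂(Measure.pi fun _ : ι => σ) ≠ 0 := by
  rw [Ne, lintegral_eq_zero_iff (measurable_tiltedWeight β a k h)]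
  intro h0
  have : ∀ᵐ φ ∂(Measure.pi fun _ : ι => σ), False := by
    filter_upwards [h0] with φ hφ
    rw [tiltedWeight, Pi.zero_apply, ENNReal.ofReal_eq_zero] at hφ
    exact absurd hφ (not_le.2 (Real.exp_pos _))
  rw [Filter.eventually_false_iff_eq_bot, ae_eq_bot] at this
  exact IsProbabilityMeasure.ne_zero _ this

end Gibbs

section Tilt

theorem exists_normalized_tilt {ρ : Measure ℝ} {a : ℝ} (ha : 0 ≤ a)
    (hρ_pos : 0 < ∫⁻ u, ENNReal.ofReal (Real.exp (a * |u| ^ 2)) ∂ρ)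
    (hρ_fin : ∫⁻ u, ENNReal.ofReal (Real.exp (a * |u| ^ 2)) ∂ρ < ⊤) :
    IsFiniteMeasure ρ ∧ IsFiniteMeasure (tilt ρ (a / 2)) ∧
      ∃ (σ : Measure ℝ) (m : ℝ≥0∞), IsProbabilityMeasure σ ∧ m ≠ 0 ∧ m ≠ ∞ ∧
        ρ = σ.withDensity (fun u => m * ENNReal.ofReal (Real.exp (-(a / 2 * u ^ 2)))) ∧
        tilt ρ (a / 2) =
          σ.withDensity (fun u => m * ENNReal.ofReal (Real.exp (-(0 / 2 * u ^ 2)))) := by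
  have hτ : tilt ρ (a / 2) Set.univ =
      ∫⁻ u, ENNReal.ofReal (Real.exp (a / 2 * |u| ^ 2)) ∂ρ := by
    rw [tilt, withDensity_apply _ MeasurableSet.univ, setLIntegral_univ]
  have hfin : IsFiniteMeasure ρ := by
    refine ⟨lt_of_le_of_lt ?_ hρ_fin⟩
    rw [← lintegral_one]
    refine lintegral_mono fun u => ?_
    rw [← ENNReal.ofReal_one]
    exact ENNReal.ofReal_le_ofReal (Real.one_le_exp (by positivity))
  have hm : tilt ρ (a / 2) Set.univ ≠ ∞ := by
    rw [hτ]
    refine (lt_of_le_of_lt (lintegral_mono fun u => ?_) hρ_fin).ne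
    refine ENNReal.ofReal_le_ofReal (Real.exp_le_exp.2 ?_)
    gcongr
    linarith
  have hm0 : tilt ρ (a / 2) Set.univ ≠ 0 := by
    rw [hτ, Ne, lintegral_eq_zero_iff (by fun_prop)]
    intro h0
    have h1 : ∀ᵐ u ∂ρ, False := by
      filter_upwards [h0] with u hu
      rw [Pi.zero_apply, ENNReal.ofReal_eq_zero] at hu
      exact absurd hu (not_le.2 (Real.exp_pos _))
    rw [Filter.eventually_false_iff_eq_bot, ae_eq_bot] at h1
    simp [h1] at hρ_pos
  set m := tilt ρ (a / 2) Set.univ with hmdef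
  refine ⟨hfin, ⟨hm.lt_top⟩, m⁻¹ • tilt ρ (a / 2), m, ⟨?_⟩, hm0, hm, ?_, ?_⟩
  · rw [Measure.smul_apply, smul_eq_mul, ENNReal.inv_mul_cancel hm0 hm]
  · rw [withDensity_smul_measure, tilt, ← withDensity_mul _ (by fun_prop) (by fun_prop)]
    have : ((fun u : ℝ => ENNReal.ofReal (Real.exp (a / 2 * |u| ^ 2))) *
        fun u => m * ENNReal.ofReal (Real.exp (-(a / 2 * u ^ 2)))) = fun _ => m := by
      funext u
      rw [Pi.mul_apply, mul_left_comm, ← ENNReal.ofReal_mul (Real.exp_pos _).le, ← Real.exp_add,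
        sq_abs, add_neg_cancel, Real.exp_zero, ENNReal.ofReal_one, mul_one]
    rw [this, withDensity_const, smul_smul, ENNReal.inv_mul_cancel hm0 hm, one_smul]
  · simp only [zero_div, zero_mul, neg_zero, Real.exp_zero, ENNReal.ofReal_one, mul_one]
    rw [withDensity_const, smul_smul, ENNReal.mul_inv_cancel hm0 hm, one_smul]

theorem exists_measure_Icc_ne_zero (σ : Measure ℝ) [IsProbabilityMeasure σ] :
    ∃ n : ℕ, σ (Set.Icc (-(n : ℝ)) n) ≠ 0 := by
  by_contra! h
  have h1 : σ (⋃ n : ℕ, Set.Icc (-(n : ℝ)) n) = 0 := measure_iUnion_null h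
  have h2 : (⋃ n : ℕ, Set.Icc (-(n : ℝ)) n) = Set.univ := by
    refine Set.eq_univ_of_forall fun x => ?_
    obtain ⟨n, hn⟩ := exists_nat_ge |x|
    exact Set.mem_iUnion.2 ⟨n, abs_le.1 hn⟩
  rw [h2] at h1
  exact IsProbabilityMeasure.ne_zero σ (Measure.measure_univ_eq_zero.1 h1)

end Tilt

section Main

variable {V : Type*}

theorem gibbsMeasure_zero_tilt {τ σ : Measure ℝ} [IsProbabilityMeasure σ] [SigmaFinite τ]
    {m : ℝ≥0∞} (hm0 : m ≠ 0) (hm : m ≠ ∞)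
    (hτ : τ = σ.withDensity fun u => m * ENNReal.ofReal (Real.exp (-(0 / 2 * u ^ 2))))
    (Λ : Finset V) : gibbsMeasure 0 τ (0 : V → V → ℝ) 0 Λ = Measure.pi fun _ : Λ => σ := by
  have h1 : ∀ (k : Λ → Λ → ℝ) (h : Λ → ℝ), tiltedWeight 0 0 k h = 1 := fun k h => by
    funext φ
    simp [tiltedWeight]
  rw [gibbsMeasure_eq hτ hm0 hm, h1]
  simp

theorem map_restrict₂_le {σ : Measure ℝ} [IsProbabilityMeasure σ] {Λ Λ' : Finset V}
    (hΛ : Λ' ⊆ Λ) {W : (Λ → ℝ) → ℝ≥0∞} {c : ℝ≥0∞}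
    (hW0 : ∫⁻ φ, W φ ∂(Measure.pi fun _ : Λ => σ) ≠ 0)
    (hW : ∫⁻ φ, W φ ∂(Measure.pi fun _ : Λ => σ) ≠ ∞)
    (h : ∀ E : Set (Λ' → ℝ), MeasurableSet E →
      ∫⁻ φ in Finset.restrict₂ (π := fun _ => ℝ) hΛ ⁻¹' E, W φ ∂(Measure.pi fun _ : Λ => σ) ≤
        c * (Measure.pi (fun _ : Λ => σ) (Finset.restrict₂ (π := fun _ => ℝ) hΛ ⁻¹' E) *
          ∫⁻ φ, W φ ∂(Measure.pi fun _ : Λ => σ))) :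
    (((∫⁻ φ, W φ ∂(Measure.pi fun _ : Λ => σ))⁻¹ •
      (Measure.pi fun _ : Λ => σ).withDensity W).map (Finset.restrict₂ (π := fun _ => ℝ) hΛ)) ≤
        c • Measure.pi fun _ : Λ' => σ := by
  have hproj : (Measure.pi fun _ : Λ' => σ) =
      (Measure.pi fun _ : Λ => σ).map (Finset.restrict₂ (π := fun _ => ℝ) hΛ) :=
    isProjectiveMeasureFamily_pi (fun _ : V => σ) Λ Λ' hΛ
  have hmeas : Measurable (Finset.restrict₂ (π := fun _ : V => ℝ) hΛ) :=
    Finset.measurable_restrict₂ hΛ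
  refine Measure.le_iff.2 fun E hE => ?_
  rw [hproj, Measure.smul_apply, Measure.map_apply hmeas hE, Measure.map_apply hmeas hE,
    Measure.smul_apply, withDensity_apply _ (hmeas hE), smul_eq_mul, smul_eq_mul]
  refine (mul_le_mul_right (h E hE) _).trans (le_of_eq ?_)
  rw [← mul_assoc c, mul_comm (c * _), ← mul_assoc, ENNReal.inv_mul_cancel hW0 hW, one_mul]

theorem abs_externalField_le {J : V → V → ℝ} {f : ℝ → ℝ} {ξ : V → ℝ} {C lam : ℝ} {Λ : Finset V}
    {A : Λ → ℝ} {S : Finset Λ}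
    (hA : ∀ x ∈ S, BoundaryCondition J f ξ C lam (Λ : Set V) x (A x)) {φ : Λ → ℝ} {y : Λ} {t : ℝ}
    (h : Threshold (fun x y : Λ => J x y) f lam (fun x => C * A x) S φ y t) :
    |externalField J ξ (Λ : Set V) y| ≤
      (∑' z : ↥((Λ : Set V)ᶜ), |J y z| * f (J y z)) * (lam * t) := by
  obtain ⟨x, hx, m, p, hp, hpm, rfl⟩ := h.exists_walk
  have := hA x hx m p hp
  rw [hpm] at this
  refine this.trans (le_of_eq ?_)
  ring

theorem IsAdmissible.sum_add_tsum_le {J : V → V → ℝ} {f : ℝ → ℝ} {δ M : ℝ}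
    (hJ : IsAdmissible J f δ M) (Λ : Finset V) (x : V) :
    ∑ y : Λ, |J x y| * f (J x y) + ∑' z : ↥((Λ : Set V)ᶜ), |J x z| * f (J x z) ≤ M := by
  rw [Finset.sum_coe_sort Λ fun y => |J x y| * f (J x y), (hJ.summable x).sum_add_tsum_compl]
  exact hJ.tsum_le x

theorem IsAdmissible.abs_mul_nonneg {J : V → V → ℝ} {f : ℝ → ℝ} {δ M : ℝ}
    (hJ : IsAdmissible J f δ M) (x y : V) : 0 ≤ |J x y| * f (J x y) :=
  mul_nonneg (abs_nonneg _) (zero_le_one.trans (hJ.one_le _))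

theorem offDiag_symm {ι : Type*} {J : ι → ι → ℝ} (hJ : ∀ x y, J x y = J y x) (x y : ι) :
    offDiag J x y = offDiag J y x := by
  by_cases h : x = y
  · rw [h]
  · simp [offDiag, h, Ne.symm h, hJ x y]

theorem abs_offDiag_le {ι : Type*} (J : ι → ι → ℝ) (x y : ι) : |offDiag J x y| ≤ |J x y| := by
  by_cases h : x = y <;> simp [offDiag, h]

theorem IsAdmissible.lintegral_tiltedWeight_ne_top {J : V → V → ℝ} {f : ℝ → ℝ} {β δ M a : ℝ}
    (hJ : IsAdmissible J f δ M) (hβ : 0 ≤ β) (hM : 0 < M) (ha : 4 * β * M ≤ a)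
    (σ : Measure ℝ) [IsProbabilityMeasure σ] (Λ : Finset V) (h : Λ → ℝ) :
    ∫⁻ φ, tiltedWeight β a (offDiag fun x y : Λ => J x y) h φ
      ∂(Measure.pi fun _ : Λ => σ) ≠ ∞ := by
  classical
  obtain ⟨c, hc⟩ := exists_tiltedWeight_le (offDiag_symm fun x y : Λ => hJ.symm x y) h hβ hM ha
    fun x => by
      calc ∑ y, |offDiag (fun x y : Λ => J x y) x y| ≤ ∑ y : Λ, |J x y| * f (J x y) :=
            Finset.sum_le_sum fun y _ => (abs_offDiag_le _ x y).trans
              (le_mul_of_one_le_right (abs_nonneg _) (hJ.one_le _))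
        _ ≤ M := le_trans (le_add_of_nonneg_right (tsum_nonneg fun z =>
            hJ.abs_mul_nonneg _ _)) (hJ.sum_add_tsum_le Λ x)
  refine (lt_of_le_of_lt (lintegral_mono hc) ?_).ne
  simp

/-- Regularity when the boundary function is finite on `Λ'`. -/
theorem setLIntegral_preimage_restrict₂_le {β δ M a K p C : ℝ} (hβ : 0 ≤ β) (hM : 0 < M)
    (hK : 0 ≤ K) (hC : 1 ≤ C) (σ : Measure ℝ) [IsProbabilityMeasure σ] (hp : 0 < p)
    (hσ : σ (Set.Icc (-K) K) = ENNReal.ofReal p) {J : V → V → ℝ} {f : ℝ → ℝ}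
    (hJ : IsAdmissible J f δ M)
    (hCf : ∀ s u : ℝ, s ≠ 0 → C * f s < |u| →
      Real.exp (a * K ^ 2) / p * Real.exp (-(a / 8 * u ^ 2)) ≤ |s| / (4 * M))
    {Λ Λ' : Finset V} (hΛ : Λ' ⊆ Λ) {lam : ℝ} (hlam : 1 ≤ lam) (ha : lam * (4 * β * M) ≤ a)
    {ξ : V → ℝ} {A : V → ℝ} (hA1 : ∀ x ∈ Λ', 1 ≤ A x)
    (hA : ∀ x ∈ Λ', BoundaryCondition J f ξ C lam (Λ : Set V) x (A x))
    {E : Set (Λ' → ℝ)} (hE : MeasurableSet E) :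
    ∫⁻ φ in Finset.restrict₂ (π := fun _ => ℝ) hΛ ⁻¹' E,
        tiltedWeight β a (offDiag fun x y : Λ => J x y)
          (fun x : Λ => externalField J ξ (Λ : Set V) x) φ ∂(Measure.pi fun _ : Λ => σ) ≤
      (∏ x ∈ Λ', ENNReal.ofReal
        (2 * (Real.exp (a * K ^ 2) / p) * Real.exp (a / 4 * (C * A x) ^ 2))) *
      (Measure.pi (fun _ : Λ => σ) (Finset.restrict₂ (π := fun _ => ℝ) hΛ ⁻¹' E) *
        ∫⁻ φ, tiltedWeight β a (offDiag fun x y : Λ => J x y)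
          (fun x : Λ => externalField J ξ (Λ : Set V) x) φ ∂(Measure.pi fun _ : Λ => σ)) := by
  classical
  have hS : ∀ x : Λ, x ∈ Λ'.subtype (· ∈ Λ) → (x : V) ∈ Λ' := fun x hx =>
    Finset.mem_subtype.1 hx
  have key := setLIntegral_tiltedWeight_le (J := fun x y : Λ => J x y) (f := f) (lam := lam)
    (T := fun x : Λ => C * A x) (S := Λ'.subtype (· ∈ Λ))
    (offDiag_symm fun x y : Λ => hJ.symm x y) (abs_offDiag_le _)
    (fun x : Λ => externalField J ξ (Λ : Set V) x)
    (fun x : Λ => ∑' z : ↥((Λ : Set V)ᶜ), |J x z| * f (J x z)) hβ (zero_le_one.trans hC) hK hM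
    hlam ha hJ.one_le
    (fun x hx => le_mul_of_one_le_right (zero_le_one.trans hC) (hA1 x (hS x hx)))
    (fun x => tsum_nonneg fun z => hJ.abs_mul_nonneg _ _) (fun x => hJ.sum_add_tsum_le Λ x)
    (fun φ y t h => abs_externalField_le (A := fun x : Λ => A x)
      (fun x hx => hA x (hS x hx)) h) σ hp hσ hCf
    (E := Finset.restrict₂ (π := fun _ => ℝ) hΛ ⁻¹' E)
    (Finset.measurable_restrict₂ hΛ hE) fun φ ψ hφψ => by
      have : Finset.restrict₂ (π := fun _ => ℝ) hΛ φ = Finset.restrict₂ (π := fun _ => ℝ) hΛ ψ :=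
        funext fun i => hφψ ⟨i, hΛ i.2⟩ (Finset.mem_subtype.2 i.2)
      simp only [Set.mem_preimage, this]
  rwa [Finset.prod_subtype_of_mem (fun x : V => ENNReal.ofReal
    (2 * (Real.exp (a * K ^ 2) / p) * Real.exp (a / 4 * (C * A x) ^ 2)))
    (fun x hx => hΛ hx)] at key

theorem isProbabilityMeasure_inv_smul_withDensity {Ω : Type*} [MeasurableSpace Ω] (μ : Measure Ω)
    {W : Ω → ℝ≥0∞} (h0 : ∫⁻ φ, W φ ∂μ ≠ 0) (h : ∫⁻ φ, W φ ∂μ ≠ ∞) :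
    IsProbabilityMeasure ((∫⁻ φ, W φ ∂μ)⁻¹ • μ.withDensity W) := by
  constructor
  rw [Measure.smul_apply, withDensity_apply _ MeasurableSet.univ, setLIntegral_univ, smul_eq_mul,
    ENNReal.inv_mul_cancel h0 h]

/-- The density bound, with constants that depend only on `β`, `δ`, `M`, `a` and the single-spin
measure. -/
theorem exists_density_bound {β δ M a : ℝ} (hβ : 0 ≤ β) (hδ : 0 < δ) (hM : 0 < M) (ha : 4 * β * M ≤ a)
    (σ : Measure ℝ) [IsProbabilityMeasure σ] :
    ∃ C C' : ℝ, 1 ≤ C ∧ 0 < C' ∧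
      ∀ (V : Type u) (J : V → V → ℝ) (f : ℝ → ℝ), IsAdmissible J f δ M →
        ∀ (Λ Λ' : Finset V) (hΛ : Λ' ⊆ Λ) (lam : ℝ), 1 ≤ lam → lam * (4 * β * M) ≤ a →
        ∀ ξ : V → ℝ, ∀ E : Set (Λ' → ℝ), MeasurableSet E →
          ∫⁻ φ in Finset.restrict₂ (π := fun _ => ℝ) hΛ ⁻¹' E,
              tiltedWeight β a (offDiag fun x y : Λ => J x y)
                (fun x : Λ => externalField J ξ (Λ : Set V) x) φ ∂(Measure.pi fun _ : Λ => σ) ≤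
            (∏ x ∈ Λ', EReal.exp
              ((C' : EReal) * (boundaryFunction J f ξ C lam (Λ : Set V) x : EReal) ^ 2)) *
            (Measure.pi (fun _ : Λ => σ) (Finset.restrict₂ (π := fun _ => ℝ) hΛ ⁻¹' E) *
              ∫⁻ φ, tiltedWeight β a (offDiag fun x y : Λ => J x y)
                (fun x : Λ => externalField J ξ (Λ : Set V) x) φ
                  ∂(Measure.pi fun _ : Λ => σ)) := by
  have ha0 : 0 ≤ a := le_trans (by positivity) ha
  obtain rfl | ha1 := ha0.eq_or_lt
  · have hβ0 : β = 0 := by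
      by_contra hne
      have : 0 < β := lt_of_le_of_ne hβ (Ne.symm hne)
      have : 0 < 4 * β * M := by positivity
      linarith
    refine ⟨1, 1, le_rfl, one_pos, fun V J f hJ Λ Λ' hΛ lam hlam hlama ξ E hE => ?_⟩
    have h1 : ∀ (k : Λ → Λ → ℝ) (h φ : Λ → ℝ), tiltedWeight β 0 k h φ = 1 := fun k h φ => by
      simp [tiltedWeight, hβ0]
    simp only [h1, lintegral_one, Measure.restrict_apply_univ, measure_univ, mul_one]
    exact le_mul_of_one_le_left zero_le
      (Finset.one_le_prod' fun y _ => one_le_exp_mul_sq one_pos _)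
  obtain ⟨n, hn⟩ := exists_measure_Icc_ne_zero σ
  set p : ℝ := (σ (Set.Icc (-(n : ℝ)) n)).toReal with hpdef
  have hp : 0 < p := ENNReal.toReal_pos hn (measure_ne_top _ _)
  have hσ : σ (Set.Icc (-(n : ℝ)) n) = ENNReal.ofReal p :=
    (ENNReal.ofReal_toReal (measure_ne_top _ _)).symm
  set L : ℝ := Real.exp (a * (n : ℝ) ^ 2) / p with hL
  have hL0 : 0 < L := by positivity
  obtain ⟨C, hC, hCf⟩ := exists_exp_neg_sq_le ha1 hδ hM hL0
  set C' : ℝ := |Real.log (2 * L)| + a / 4 * C ^ 2 with hC'def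
  have hC' : 0 < C' := by positivity
  refine ⟨C, C', hC, hC', fun V J f hJ Λ Λ' hΛ lam hlam hlama ξ E hE => ?_⟩
  by_cases htop : ∃ x ∈ Λ', boundaryFunction J f ξ C lam (Λ : Set V) x = ∞
  · obtain ⟨x, hx, hxtop⟩ := htop
    rw [prod_exp_eq_top hC' hx hxtop]
    by_cases h0 : Measure.pi (fun _ : Λ => σ) (Finset.restrict₂ (π := fun _ => ℝ) hΛ ⁻¹' E) = 0
    · rw [Measure.restrict_zero_set h0]
      simp
    · rw [ENNReal.top_mul (mul_ne_zero h0 (lintegral_tiltedWeight_pos _ _ _ _ _))]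
      exact le_top
  · push Not at htop
    choose! A hA1 hA hAeq using fun x (hx : x ∈ Λ') => exists_boundaryFunction_eq (htop x hx)
    refine (setLIntegral_preimage_restrict₂_le hβ hM n.cast_nonneg hC σ hp hσ hJ
      (hCf f hJ.one_le hJ.sqrt_log_le) hΛ hlam hlama hA1 hA hE).trans ?_
    refine mul_le_mul_left (Finset.prod_le_prod' fun x hx => ?_) _
    have hAx := hA1 x hx
    rw [hAeq x hx, exp_mul_ofReal_sq (zero_le_one.trans hAx)]
    refine ENNReal.ofReal_le_ofReal ?_
    rw [← hL]
    have h2 : 2 * L ≤ Real.exp (|Real.log (2 * L)| * A x ^ 2) := by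
      rw [← Real.log_le_iff_le_exp (by positivity)]
      exact (le_abs_self _).trans
        (le_mul_of_one_le_right (abs_nonneg _) (one_le_pow₀ hAx))
    calc 2 * L * Real.exp (a / 4 * (C * A x) ^ 2)
        ≤ Real.exp (|Real.log (2 * L)| * A x ^ 2) * Real.exp (a / 4 * (C * A x) ^ 2) := by gcongr
      _ = Real.exp (C' * A x ^ 2) := by
        rw [← Real.exp_add, hC'def]
        congr 1
        ring

end Main

end SpinSystem

end

theorem mainTheorem2 (β δ M a : ℝ) (hβ : 0 ≤ β) (hδ : 0 < δ) (hM : 0 < M)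
    (ha : 4 * β * M ≤ a) (ρ : Measure ℝ)
    (hρ_pos : 0 < ∫⁻ u, ENNReal.ofReal (Real.exp (a * |u| ^ 2)) ∂ρ)
    (hρ_fin : ∫⁻ u, ENNReal.ofReal (Real.exp (a * |u| ^ 2)) ∂ρ < ⊤) :
    ∃ C C' : ℝ, 1 ≤ C ∧ 0 < C' ∧
      ∀ (V : Type u) [Countable V] (J : V → V → ℝ) (f : ℝ → ℝ),
        SpinSystem.IsAdmissible J f δ M →
        ∀ (Λ Λ' : Finset V) (hΛ : Λ' ⊆ Λ) (lam : ℝ), 1 ≤ lam → lam * (4 * β * M) ≤ a →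
        ∀ ξ : V → ℝ, (∀ x ∈ Λ, Summable fun y => |J x y * ξ y|) →
          IsProbabilityMeasure (SpinSystem.gibbsMeasure β ρ J ξ Λ) ∧
          (SpinSystem.gibbsMeasure β ρ J ξ Λ).map (Finset.restrict₂ (π := fun _ => ℝ) hΛ) ≤
            (∏ x ∈ Λ', EReal.exp
                ((C' : EReal) *
                  (SpinSystem.boundaryFunction J f ξ C lam (Λ : Set V) x : EReal) ^ 2)) •
              SpinSystem.gibbsMeasure 0 (SpinSystem.tilt ρ (a / 2)) (0 : V → V → ℝ) 0 Λ' := by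
  have ha0 : 0 ≤ a := le_trans (by positivity) ha
  obtain ⟨_, _, σ, m, _, hm0, hm, hρ, hτ⟩ :=
    SpinSystem.exists_normalized_tilt ha0 hρ_pos hρ_fin
  obtain ⟨C, C', hC, hC', H⟩ := SpinSystem.exists_density_bound.{u} hβ hδ hM ha σ
  refine ⟨C, C', hC, hC', fun V _ J f hJ Λ Λ' hΛ lam hlam hlama ξ _ => ?_⟩
  have hZ0 := SpinSystem.lintegral_tiltedWeight_pos σ β a (SpinSystem.offDiag fun x y : Λ => J x y)
    fun x : Λ => SpinSystem.externalField J ξ (Λ : Set V) x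
  have hZ := hJ.lintegral_tiltedWeight_ne_top hβ hM ha σ Λ
    fun x : Λ => SpinSystem.externalField J ξ (Λ : Set V) x
  rw [SpinSystem.gibbsMeasure_eq hρ hm0 hm, SpinSystem.gibbsMeasure_zero_tilt hm0 hm hτ]
  exact ⟨SpinSystem.isProbabilityMeasure_inv_smul_withDensity _ hZ0 hZ,
    SpinSystem.map_restrict₂_le hΛ hZ0 hZ (H V J f hJ Λ Λ' hΛ lam hlam hlama ξ)⟩
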